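/- Let $2<p<6$. For real-valued $u\in H^1(\mathbb R)$ (identified with its continuous representative) put $$E(u,\mathbb R)=\frac12\int_{\mathbb R}|u'|^2\,dx-\frac1p\int_{\mathbb R}|u|^p\,dx .$$ For every $\mu>0$ there is a unique positive even function minimizing $E(\cdot,\mathbb R)$ over $\{u\in H^1(\mathbb R):\|u\|_{L^2(\mathbb R)}^2=\mu\}$; it is denoted by $\phi_\mu$ and called the soliton of mass $\mu$. Let $a,m>0$ be given, and consider the problem $$\min E(\phi,\mathbb R),\qquad \phi\in H^1(\mathbb R),\qquad \int_{-\infty}^{\infty}|\phi|^2\,dx=m,\qquad \phi(0)=a. \tag{P}$$ (i) If $a<\phi_m(0)$, then (P) has exactly two solutions, given by $x\mapsto\phi_m(x+y)$ and $x\mapsto\phi_m(x-y)$ for a suitable $y>0$. (ii) If $a=\phi_m(0)$, then (P) has $\phi_m$ as its unique solution. (iii) If $a>\phi_m(0)$, then (P) has exactly one solution, namely $x\mapsto\phi_M(|x|+y)$ for suitable $M,y>0$. -/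

import Mathlib

open MeasureTheory
open scoped ContDiff

noncomputable section

namespace NLSLine

/-- `g` is a weak derivative of `u` on the real line, tested against smooth compactly supported
functions. It is only used for continuous `u` and square integrable `g`, for which all the
integrals converge. -/
def HasWeakDeriv (u g : ℝ → ℝ) : Prop :=
  ∀ η : ℝ → ℝ, ContDiff ℝ ∞ η → HasCompactSupport η →
    ∫ x, u x * deriv η x = -∫ x, g x * η x

/-- The Sobolev space `H¹(ℝ)` of real-valued functions; every element is represented by its
continuous representative. -/
structure MemH1 (u : ℝ → ℝ) : Prop where
  continuous : Continuous u
  memLp : MemLp u 2 volume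
  exists_weakDeriv : ∃ g : ℝ → ℝ, MemLp g 2 volume ∧ HasWeakDeriv u g

/-- The square integrable weak derivative of an element of `H¹(ℝ)` (determined up to a null set);
by convention it is `0` if there is none. -/
def weakDeriv (u : ℝ → ℝ) : ℝ → ℝ :=
  open Classical in
  if h : ∃ g : ℝ → ℝ, MemLp g 2 volume ∧ HasWeakDeriv u g then h.choose else 0

/-- The mass `‖u‖²` in `L²(ℝ)`. -/
def mass (u : ℝ → ℝ) : ℝ := ∫ x, u x ^ 2

/-- The NLS energy `E(u, ℝ) = 1/2 ‖u'‖₂² - 1/p ‖u‖ₚᵖ`. -/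
def energy (p : ℝ) (u : ℝ → ℝ) : ℝ :=
  (1 / 2) * (∫ x, weakDeriv u x ^ 2) - (1 / p) * ∫ x, |u x| ^ p

/-- The constraint set `H¹_μ(ℝ)` of functions in `H¹(ℝ)` of mass `μ`. -/
def H1Mass (μ : ℝ) : Set (ℝ → ℝ) := {u | MemH1 u ∧ mass u = μ}

/-- `φ` is a positive even minimizer of the energy among functions of mass `μ`. -/
structure IsSoliton (p μ : ℝ) (φ : ℝ → ℝ) : Prop where
  mem : φ ∈ H1Mass μ
  isMin : IsMinOn (energy p) (H1Mass μ) φ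
  pos : ∀ x, 0 < φ x
  even : ∀ x, φ (-x) = φ x

/-- The soliton `φ_μ`: the positive even minimizer of the energy among functions of mass `μ`. -/
def soliton (p μ : ℝ) : ℝ → ℝ := Classical.epsilon (IsSoliton p μ)

/-- The functions in `H¹(ℝ)` with mass `m` and value `a` at the origin. -/
def Admissible (m a : ℝ) : Set (ℝ → ℝ) := {u | MemH1 u ∧ mass u = m ∧ u 0 = a}

/-- The set of solutions of the problem of minimizing the energy over `Admissible m a`. -/
def solutions (p m a : ℝ) : Set (ℝ → ℝ) :=
  {u | u ∈ Admissible m a ∧ IsMinOn (energy p) (Admissible m a) u}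

end NLSLine

end

/-! The proof is a calibration in mass coordinates. Let `φ` be a positive even solution of the
stationary equation with derivative `ψ`, and let `τ` match the mass of `u` left of `x` with the mass
of `φ` left of `τ x`, so that `τ' = u² / φ(τ)²`. Then the energy density of `u` equals the
derivative of `u⁴ * slope(τ) + potential(τ)`, plus half the square of `u' - u³ψ(τ)/φ(τ)³`, plus
`defect` (`density_eq_of_defect`). The defect is nonnegative by Bernoulli's inequality with exponent
`(p - 2) / 4`, which lies in `(0, 1)` exactly because `2 < p < 6`. Integration bounds the energy on
a half-line below by boundary data (`Profile.calibration_Iic`). In the equality case `τ'` takes only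
the values 0 and 1, hence is 1 by continuity, and `u` is a translate of `φ` up to sign
(`Profile.sq_eq_of_calibration_Iic_le`).

Apply this on both sides of the median `x₁` of the mass of `u`. If `u` and `φ` have equal mass, the
median of `φ` is 0, where `slope` vanishes, and the bound is the energy of `φ`. So the minimizers at
fixed mass are the translates of `φ` and of `-φ`. For `a ≤ φ_m(0)` some translates take the value
`a` at 0, and they solve (P).

For `a > φ_m(0)`, take a profile `φ` and `y > 0` with `φ y = a` and mass `m` outside `[-y, y]`
(`exists_sech_eq`), and calibrate with this larger profile. If the median of `u` is 0, the bound is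
the energy of `φ(|x| + y)`. Otherwise the energy is strictly larger
(`Profile.energy_gt_of_leftMass_lt`), because `slope` is positive at `-y` and strictly decreasing.

Profiles are explicit powers of the hyperbolic secant, and scaling gives every mass. -/

open Set Filter Topology

namespace NLSLine

/-! ### Weak derivatives and absolutely continuous primitives. -/

/-- `u` is a primitive of the locally integrable function `g`. -/
structure IsPrimitive (u g : ℝ → ℝ) : Prop where
  locallyIntegrable : LocallyIntegrable g
  sub_eq : ∀ x y, u y - u x = ∫ t in x..y, g t

theorem intervalIntegrable_of_locallyIntegrable {g : ℝ → ℝ} (hg : LocallyIntegrable g) (a b : ℝ) :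
    IntervalIntegrable g volume a b :=
  intervalIntegrable_iff.mpr <|
    (hg.integrableOn_isCompact isCompact_uIcc).mono_set uIoc_subset_uIcc

theorem IsPrimitive.eq_add {u g : ℝ → ℝ} (h : IsPrimitive u g) (a : ℝ) :
    u = fun x => u a + ∫ t in a..x, g t := by
  funext x
  linarith [h.sub_eq a x]

theorem IsPrimitive.continuous {u g : ℝ → ℝ} (h : IsPrimitive u g) : Continuous u := by
  rw [h.eq_add 0]
  exact continuous_const.add (intervalIntegral.continuous_primitive
    (fun a b => intervalIntegrable_of_locallyIntegrable h.locallyIntegrable a b) 0)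

theorem IsPrimitive.absolutelyContinuous {u g : ℝ → ℝ} (h : IsPrimitive u g) (a b : ℝ) :
    AbsolutelyContinuousOnInterval u a b := by
  have h1 := (intervalIntegrable_of_locallyIntegrable h.locallyIntegrable a
    b).absolutelyContinuousOnInterval_intervalIntegral (c := a) left_mem_uIcc
  have h2 : AbsolutelyContinuousOnInterval (fun _ : ℝ => u a) a b :=
    (contDiff_const (n := 1)).contDiffOn.absolutelyContinuousOnInterval
  have := h2.add h1
  rw [h.eq_add a]
  exact this

theorem IsPrimitive.ae_hasDerivAt {u g : ℝ → ℝ} (h : IsPrimitive u g) :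
    ∀ᵐ x, HasDerivAt u (g x) x := by
  filter_upwards [LocallyIntegrable.ae_hasDerivAt_integral h.locallyIntegrable] with x hx
  rw [h.eq_add 0]
  exact (hx 0).const_add _

theorem IsPrimitive.ae_eq {u g g' : ℝ → ℝ} (h : IsPrimitive u g) (h' : IsPrimitive u g') :
    g =ᵐ[volume] g' := by
  filter_upwards [h.ae_hasDerivAt, h'.ae_hasDerivAt] with x h1 h2
  exact h1.unique h2

/-- The integral of a function vanishing off `[-N, N]`. -/
theorem integral_eq_intervalIntegral_of_eq_zero {f : ℝ → ℝ} {N : ℝ} (hN : 0 ≤ N)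
    (hf : ∀ x, N ≤ |x| → f x = 0) : ∫ x, f x = ∫ x in (-N)..N, f x := by
  rw [intervalIntegral.integral_of_le (by linarith), setIntegral_eq_integral_of_forall_compl_eq_zero]
  intro x hx
  apply hf
  by_contra! h
  exact hx ⟨(abs_lt.1 h).1, (abs_lt.1 h).2.le⟩

theorem exists_bound_of_hasCompactSupport {η : ℝ → ℝ} (hs : HasCompactSupport η) :
    ∃ N : ℝ, 0 < N ∧ (∀ x, N ≤ |x| → η x = 0) ∧ ∀ x, N ≤ |x| → deriv η x = 0 := by
  obtain ⟨N, hN⟩ := hs.isCompact.isBounded.subset_closedBall 0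
  refine ⟨|N| + 1, by positivity, fun x hx => ?_, fun x hx => ?_⟩
  all_goals
    have hx' : x ∉ tsupport η := by
      intro h
      have := hN h
      rw [mem_closedBall_zero_iff, Real.norm_eq_abs] at this
      linarith [le_abs_self N]
  · exact image_eq_zero_of_notMem_tsupport hx'
  · exact image_eq_zero_of_notMem_tsupport fun h => hx' (tsupport_deriv_subset h)

theorem IsPrimitive.hasWeakDeriv {u g : ℝ → ℝ} (h : IsPrimitive u g) : HasWeakDeriv u g := by
  intro η hη hs
  obtain ⟨N, hN, h0, h1⟩ := exists_bound_of_hasCompactSupport hs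
  have hη1 : AbsolutelyContinuousOnInterval η (-N) N :=
    (hη.of_le (by exact_mod_cast le_top)).contDiffOn.absolutelyContinuousOnInterval
  rw [integral_eq_intervalIntegral_of_eq_zero hN.le (fun x hx => by rw [h1 x hx, mul_zero]),
    integral_eq_intervalIntegral_of_eq_zero hN.le (fun x hx => by rw [h0 x hx, mul_zero]),
    (h.absolutelyContinuous (-N) N).integral_mul_deriv_eq_deriv_mul hη1,
    h0 N (le_abs_self N), h0 (-N) (by rw [abs_neg]; exact le_abs_self N)]
  simp only [mul_zero, sub_zero, zero_sub, neg_inj]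
  apply intervalIntegral.integral_congr_ae
  filter_upwards [h.ae_hasDerivAt] with x hx _
  rw [hx.deriv]

/-- A continuous function with vanishing weak derivative is constant. -/
theorem eq_of_hasWeakDeriv_zero {v : ℝ → ℝ} (hv : Continuous v)
    (h : ∀ η : ℝ → ℝ, ContDiff ℝ ∞ η → HasCompactSupport η → ∫ x, v x * deriv η x = 0)
    (x y : ℝ) : v x = v y := by
  set d := y - x with hd
  have key : ∀ᵐ z, v z - v (z + d) = 0 := by
    have hloc : LocallyIntegrable (fun z => v z - v (z + d)) :=
      (hv.sub (hv.comp (continuous_id.add continuous_const))).locallyIntegrable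
    refine ae_eq_zero_of_integral_contDiff_smul_eq_zero hloc fun η hη hs => ?_
    obtain ⟨N, hN, h0, -⟩ := exists_bound_of_hasCompactSupport hs
    set H : ℝ → ℝ := fun z => ∫ t in (0 : ℝ)..z, η t with hH
    -- `H` itself need not have compact support, but `H z - H (z - d)` does. Testing with it gives
    -- the orthogonality of `v - v (· + d)` to every `η`.
    have hHd : ∀ z, HasDerivAt H (η z) z := fun z =>
      intervalIntegral.integral_hasDerivAt_right (hη.continuous.intervalIntegrable _ _)
        (hη.continuous.stronglyMeasurableAtFilter _ _) hη.continuous.continuousAt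
    have hHs : ContDiff ℝ ∞ H := by
      rw [contDiff_infty_iff_deriv]
      refine ⟨fun z => (hHd z).differentiableAt, ?_⟩
      rwa [show deriv H = η from funext fun z => (hHd z).deriv]
    have hζd : ∀ z, HasDerivAt (fun z => H z - H (z - d)) (η z - η (z - d)) z := fun z =>
      (hHd z).sub (by simpa using (hHd (z - d)).comp_sub_const z d)
    have hsmooth : ContDiff ℝ ∞ (fun z => H z - H (z - d)) :=
      hHs.sub (hHs.comp (contDiff_id.sub contDiff_const))
    have hsupp : HasCompactSupport (fun z => H z - H (z - d)) := by
      refine HasCompactSupport.intro (isCompact_Icc (a := -(N + |d|)) (b := N + |d|))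
        fun z hz => ?_
      have hz' : N + |d| < |z| := by
        by_contra! hc
        exact hz (abs_le.1 hc)
      have : H z - H (z - d) = ∫ t in (z - d)..z, η t := by
        rw [hH]
        exact intervalIntegral.integral_interval_sub_left
          (hη.continuous.intervalIntegrable _ _) (hη.continuous.intervalIntegrable _ _)
      rw [this]
      refine (intervalIntegral.integral_congr (g := fun _ => (0 : ℝ)) fun t ht => ?_).trans
        (by simp)
      apply h0
      rw [uIcc_comm] at ht
      have h2 := abs_sub_left_of_mem_uIcc ht
      have h3 := abs_sub_abs_le_abs_sub z t
      have h4 : |z - t| = |t - z| := abs_sub_comm _ _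
      have h5 : |z - d - z| = |d| := by rw [show z - d - z = -d by ring, abs_neg]
      linarith
    have e := h _ hsmooth hsupp
    simp only [(hζd _).deriv] at e
    have i1 : Integrable (fun z => v z * η z) :=
      (hv.mul hη.continuous).integrable_of_hasCompactSupport hs.mul_left
    have i2 : Integrable (fun z => v (z + d) * η z) :=
      ((hv.comp (continuous_id.add continuous_const)).mul
        hη.continuous).integrable_of_hasCompactSupport hs.mul_left
    have i3 : Integrable (fun z => v z * η (z - d)) := by
      simpa using i2.comp_sub_right d
    have e2 : ∫ z, v z * η (z - d) = ∫ z, v (z + d) * η z := by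
      rw [← integral_sub_right_eq_self (fun z => v (z + d) * η z) d]
      simp
    simp only [mul_sub] at e
    rw [integral_sub i1 i3, e2, ← integral_sub i1 i2] at e
    rw [← e]
    congr 1
    funext z
    simp only [smul_eq_mul]
    ring
  have hc : Continuous fun z => v z - v (z + d) :=
    hv.sub (hv.comp (continuous_id.add continuous_const))
  have := (Continuous.ae_eq_iff_eq volume hc continuous_const).1 key
  have := congrFun this x
  simp only [hd, add_sub_cancel] at this
  linarith

theorem HasWeakDeriv.isPrimitive {u g : ℝ → ℝ} (hu : Continuous u) (hg : LocallyIntegrable g)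
    (h : HasWeakDeriv u g) : IsPrimitive u g := by
  set G : ℝ → ℝ := fun x => ∫ t in (0 : ℝ)..x, g t with hG
  have hGp : IsPrimitive G g := ⟨hg, fun x y => by
    rw [hG]
    exact intervalIntegral.integral_interval_sub_left
      (intervalIntegrable_of_locallyIntegrable hg _ _)
      (intervalIntegrable_of_locallyIntegrable hg _ _)⟩
  have hv : ∀ x y, u x - G x = u y - G y := by
    refine eq_of_hasWeakDeriv_zero (hu.sub hGp.continuous) fun η hη hs => ?_
    have hd : Continuous (deriv η) := hη.continuous_deriv (by simp)
    have i1 : Integrable (fun z => u z * deriv η z) :=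
      (hu.mul hd).integrable_of_hasCompactSupport hs.deriv.mul_left
    have i2 : Integrable (fun z => G z * deriv η z) :=
      (hGp.continuous.mul hd).integrable_of_hasCompactSupport hs.deriv.mul_left
    simp only [sub_mul]
    rw [integral_sub i1 i2, h η hη hs, hGp.hasWeakDeriv η hη hs, sub_self]
  exact ⟨hg, fun x y => by linarith [hv x y, hGp.sub_eq x y]⟩

theorem memLp_two_locallyIntegrable {g : ℝ → ℝ} (hg : MemLp g 2 volume) : LocallyIntegrable g :=
  hg.locallyIntegrable (by norm_num)

/-! ### Decay, boundedness and integrability in `H¹(ℝ)`. -/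

/-- `u` is a square integrable primitive of the square integrable function `g`. -/
structure H1Pair (u g : ℝ → ℝ) : Prop extends IsPrimitive u g where
  memLp : MemLp u 2 volume
  memLp_deriv : MemLp g 2 volume

theorem H1Pair.memH1 {u g : ℝ → ℝ} (h : H1Pair u g) : MemH1 u :=
  ⟨h.continuous, h.memLp, g, h.memLp_deriv, h.hasWeakDeriv⟩

theorem MemH1.h1Pair {u : ℝ → ℝ} (h : MemH1 u) : H1Pair u (weakDeriv u) := by
  have hs := h.exists_weakDeriv.choose_spec
  have : weakDeriv u = h.exists_weakDeriv.choose := dif_pos h.exists_weakDeriv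
  rw [this]
  exact ⟨hs.2.isPrimitive h.continuous (memLp_two_locallyIntegrable hs.1), h.memLp, hs.1⟩

theorem H1Pair.energy_eq {u g : ℝ → ℝ} (h : H1Pair u g) (p : ℝ) :
    energy p u = (1 / 2) * (∫ x, g x ^ 2) - (1 / p) * ∫ x, |u x| ^ p := by
  have : weakDeriv u =ᵐ[volume] g :=
    h.memH1.h1Pair.toIsPrimitive.ae_eq h.toIsPrimitive
  have e : ∫ x, weakDeriv u x ^ 2 = ∫ x, g x ^ 2 :=
    integral_congr_ae (this.fun_comp (· ^ 2))
  rw [energy, e]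

theorem H1Pair.comp_neg {u g : ℝ → ℝ} (h : H1Pair u g) :
    H1Pair (fun x => u (-x)) (fun x => -g (-x)) := by
  have hg : MemLp (fun x => -g (-x)) 2 volume :=
    (h.memLp_deriv.comp_measurePreserving (Measure.measurePreserving_neg volume)).neg
  refine ⟨⟨memLp_two_locallyIntegrable hg, fun x y => ?_⟩,
    h.memLp.comp_measurePreserving (Measure.measurePreserving_neg volume), hg⟩
  rw [h.sub_eq, intervalIntegral.integral_neg, intervalIntegral.integral_comp_neg,
    intervalIntegral.integral_symm]

theorem H1Pair.integrable_sq {u g : ℝ → ℝ} (h : H1Pair u g) : Integrable fun x => u x ^ 2 :=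
  h.memLp.integrable_sq

theorem H1Pair.integrable_deriv_sq {u g : ℝ → ℝ} (h : H1Pair u g) : Integrable fun x => g x ^ 2 :=
  h.memLp_deriv.integrable_sq

theorem H1Pair.sq_sub_sq {u g : ℝ → ℝ} (h : H1Pair u g) (x y : ℝ) :
    u y ^ 2 - u x ^ 2 = ∫ t in x..y, 2 * (u t * g t) := by
  have hac := h.absolutelyContinuous x y
  rw [pow_two, pow_two, ← hac.integral_deriv_mul_eq_sub hac]
  apply intervalIntegral.integral_congr_ae
  filter_upwards [h.ae_hasDerivAt] with t ht _
  rw [ht.deriv]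
  ring

theorem H1Pair.integrable_mul {u g : ℝ → ℝ} (h : H1Pair u g) :
    Integrable fun t => 2 * (u t * g t) :=
  (h.memLp.integrable_mul h.memLp_deriv).const_mul 2

/-- Since `(u²)' = 2uu'` is integrable, `u²` has a limit at `-∞`, and integrability of `u²` forces
this limit to be 0. -/
theorem H1Pair.tendsto_atBot {u g : ℝ → ℝ} (h : H1Pair u g) : Tendsto u atBot (𝓝 0) := by
  have h1 : Tendsto (fun x => u x ^ 2) atBot
      (𝓝 (u 0 ^ 2 - ∫ t in Iic 0, 2 * (u t * g t))) := by
    have := (intervalIntegral_tendsto_integral_Iic 0 h.integrable_mul.integrableOn tendsto_id)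
    refine (this.const_sub (u 0 ^ 2)).congr fun x => ?_
    simp only [id, ← h.sq_sub_sq]
    ring
  have h2 : u 0 ^ 2 - ∫ t in Iic 0, 2 * (u t * g t) = 0 := by
    refine IntegrableAtFilter.eq_zero_of_tendsto (μ := volume) (l := atBot)
      ⟨univ, univ_mem, h.integrable_sq.integrableOn⟩ (fun s hs => ?_) h1
    obtain ⟨b, hb⟩ := mem_atBot_sets.1 hs
    rw [← top_le_iff, ← Real.volume_Iic (a := b)]
    exact measure_mono hb
  rw [h2] at h1
  have h3 := h1.sqrt
  simp only [Real.sqrt_sq_eq_abs, Real.sqrt_zero] at h3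
  exact (tendsto_zero_iff_abs_tendsto_zero _).2 h3

theorem H1Pair.exists_bound {u g : ℝ → ℝ} (h : H1Pair u g) : ∃ C, ∀ x, |u x| ≤ C := by
  refine ⟨√(u 0 ^ 2 + ∫ t, |2 * (u t * g t)|), fun x => Real.abs_le_sqrt ?_⟩
  have h1 : |∫ t in (0 : ℝ)..x, 2 * (u t * g t)| ≤ ∫ t, |2 * (u t * g t)| := by
    refine (intervalIntegral.norm_integral_le_integral_norm_uIoc (f := fun t => 2 * (u t * g t))).trans ?_
    exact setIntegral_le_integral h.integrable_mul.norm (Eventually.of_forall fun _ => norm_nonneg _)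
  linarith [h.sq_sub_sq 0 x, le_abs_self (∫ t in (0 : ℝ)..x, 2 * (u t * g t))]

theorem H1Pair.integrable_rpow {u g : ℝ → ℝ} (h : H1Pair u g) {p : ℝ} (hp : 2 < p) :
    Integrable fun x => |u x| ^ p := by
  obtain ⟨C, hC⟩ := h.exists_bound
  refine (h.integrable_sq.const_mul (C ^ (p - 2))).mono'
    ((h.continuous.abs.rpow_const fun x => Or.inr (by linarith)).aestronglyMeasurable)
    (Eventually.of_forall fun x => ?_)
  rw [Real.norm_of_nonneg (by positivity)]
  have : |u x| ^ p = |u x| ^ (p - 2) * u x ^ 2 := by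
    rcases eq_or_ne (u x) 0 with h0 | h0
    · simp [h0, Real.zero_rpow (show p ≠ 0 by linarith)]
    · rw [← sq_abs, ← Real.rpow_two, ← Real.rpow_add (abs_pos.2 h0)]
      ring_nf
  rw [this]
  have := Real.rpow_le_rpow (abs_nonneg _) (hC x) (show 0 ≤ p - 2 by linarith)
  gcongr

/-! ### Profiles and the ingredients of the calibration. -/

/-- A positive even function, decreasing on the half-line, solving the stationary NLS equation in
the form `φ φ'' = φ'² - (1 - 2 / p) φ ^ p`; here `ψ` is the derivative of `φ`. -/
structure Profile (p : ℝ) (φ ψ : ℝ → ℝ) : Prop where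
  pos : ∀ t, 0 < φ t
  even : ∀ t, φ (-t) = φ t
  hasDerivAt : ∀ t, HasDerivAt φ (ψ t) t
  hasDerivAt_deriv : ∀ t, HasDerivAt ψ ((ψ t ^ 2 - (1 - 2 / p) * φ t ^ p) / φ t) t
  deriv_neg : ∀ t, 0 < t → ψ t < 0
  exists_abs_deriv_le : ∃ C, ∀ t, |ψ t| ≤ C * φ t
  h1Pair : H1Pair φ ψ

/-- The mass of `u` on the left of `x`. -/
noncomputable def leftMass (u : ℝ → ℝ) (x : ℝ) : ℝ := ∫ t in Iic x, u t ^ 2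

/-- A right inverse of `leftMass`. -/
noncomputable def invMass (φ : ℝ → ℝ) : ℝ → ℝ := Function.invFun (leftMass φ)

/-- The slope of the calibration. -/
noncomputable def slope (φ ψ : ℝ → ℝ) (t : ℝ) : ℝ := ψ t / (4 * φ t ^ 3)

/-- The potential part of the calibration. -/
noncomputable def potential (p : ℝ) (φ : ℝ → ℝ) (t : ℝ) : ℝ :=
  -((6 - p) / (4 * p)) * ∫ x in Iic t, |φ x| ^ p

/-- The energy density of `u`, where `g` is the derivative of `u`. -/
noncomputable def density (p : ℝ) (u g : ℝ → ℝ) (x : ℝ) : ℝ := g x ^ 2 / 2 - |u x| ^ p / p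

/-- The defect in the weighted arithmetic-geometric mean inequality behind the calibration. -/
noncomputable def defect (p v r : ℝ) : ℝ :=
  v ^ 2 * r ^ p * ((p - 2) / 4 * (v ^ 4 / r ^ 6) + (6 - p) / 4 / r ^ 2) / p - |v| ^ p / p

/-! ### The pointwise inequality behind the calibration. -/

section defect

variable {p v r : ℝ}

/-- Factoring out `v² r^(p-2) / p` leaves the gap in Bernoulli's inequality for `s = v⁴/r⁴ - 1` and
exponent `(p - 2) / 4`. -/
theorem defect_eq (hv : v ≠ 0) (hr : 0 < r) :
    defect p v r = v ^ 2 * r ^ (p - 2) / p *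
      (1 + (p - 2) / 4 * (v ^ 4 / r ^ 4 - 1) - (1 + (v ^ 4 / r ^ 4 - 1)) ^ ((p - 2) / 4)) := by
  have hv' : 0 < |v| := abs_pos.2 hv
  have h1 : |v| ^ p = v ^ 2 * |v| ^ (p - 2) := by
    rw [← sq_abs v, ← Real.rpow_two, ← Real.rpow_add hv']
    ring_nf
  have h2 : r ^ p = r ^ 2 * r ^ (p - 2) := by
    rw [← Real.rpow_two, ← Real.rpow_add hr]
    ring_nf
  have h3 : (1 + (v ^ 4 / r ^ 4 - 1)) ^ ((p - 2) / 4) = |v| ^ (p - 2) / r ^ (p - 2) := by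
    have e : 1 + (v ^ 4 / r ^ 4 - 1) = (|v| / r) ^ (4 : ℝ) := by
      rw [show (4 : ℝ) = ((4 : ℕ) : ℝ) by norm_num, Real.rpow_natCast, div_pow,
        show |v| ^ 4 = v ^ 4 from Even.pow_abs (by decide) v]
      ring
    rw [e, ← Real.rpow_mul (by positivity), ← Real.div_rpow hv'.le hr.le]
    congr 1
    ring
  have h4 : 0 < r ^ (p - 2) := by positivity
  rw [h3, defect, h1, h2]
  field_simp
  ring

theorem defect_nonneg (hp2 : 2 < p) (hp6 : p < 6) (hr : 0 < r) : 0 ≤ defect p v r := by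
  rcases eq_or_ne v 0 with rfl | hv
  · simp [defect, Real.zero_rpow (show p ≠ 0 by linarith)]
  · rw [defect_eq hv hr]
    have h0 : 0 ≤ v ^ 4 / r ^ 4 := by positivity
    have := rpow_one_add_le_one_add_mul_self (s := v ^ 4 / r ^ 4 - 1) (by linarith)
      (p := (p - 2) / 4) (by linarith) (by linarith)
    have h1 : 0 ≤ v ^ 2 * r ^ (p - 2) / p := by positivity
    exact mul_nonneg h1 (by linarith)

/-- Bernoulli's inequality is strict for `s ≠ 0`. The case `v = 0` comes from the prefactor and
cannot be excluded pointwise. -/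
theorem eq_zero_or_sq_eq_of_defect_eq_zero (hp2 : 2 < p) (hp6 : p < 6) (hr : 0 < r)
    (h : defect p v r = 0) : v = 0 ∨ v ^ 2 = r ^ 2 := by
  by_contra! hc
  obtain ⟨hv, hvr⟩ := hc
  rw [defect_eq hv hr] at h
  have h0 : 0 ≤ v ^ 4 / r ^ 4 := by positivity
  have hne : v ^ 4 / r ^ 4 - 1 ≠ 0 := by
    intro h1
    rw [sub_eq_zero, div_eq_one_iff_eq (by positivity)] at h1
    apply hvr
    have h2 : (v ^ 2) ^ 2 = (r ^ 2) ^ 2 := by rw [← pow_mul, ← pow_mul, h1]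
    exact (pow_left_inj₀ (by positivity) (by positivity) two_ne_zero).1 h2
  have := rpow_one_add_lt_one_add_mul_self (s := v ^ 4 / r ^ 4 - 1) (by linarith) hne
    (p := (p - 2) / 4) (by linarith) (by linarith)
  have h1 : 0 < v ^ 2 * r ^ (p - 2) / p := by positivity
  have := mul_pos h1 (sub_pos.2 this)
  linarith

end defect

/-! ### Mass to the left of a point and splitting of the energy. -/

section leftMass

variable {u g : ℝ → ℝ}

theorem H1Pair.hasDerivAt_leftMass (h : H1Pair u g) (x : ℝ) :
    HasDerivAt (leftMass u) (u x ^ 2) x := by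
  have hc : Continuous fun t => u t ^ 2 := h.continuous.pow 2
  have e : leftMass u = fun y => leftMass u 0 + ∫ t in (0 : ℝ)..y, u t ^ 2 := by
    funext y
    have := intervalIntegral.integral_Iic_sub_Iic (μ := volume) (a := 0) (b := y)
      h.integrable_sq.integrableOn h.integrable_sq.integrableOn
    simp only [leftMass] at *
    linarith
  rw [e]
  exact (intervalIntegral.integral_hasDerivAt_right (hc.intervalIntegrable _ _)
    (hc.stronglyMeasurableAtFilter _ _) hc.continuousAt).const_add _

theorem H1Pair.continuous_leftMass (h : H1Pair u g) : Continuous (leftMass u) :=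
  continuous_iff_continuousAt.2 fun x => (h.hasDerivAt_leftMass x).continuousAt

theorem leftMass_nonneg (u : ℝ → ℝ) (x : ℝ) : 0 ≤ leftMass u x :=
  setIntegral_nonneg measurableSet_Iic fun t _ => sq_nonneg (u t)

theorem H1Pair.monotone_leftMass (h : H1Pair u g) : Monotone (leftMass u) :=
  monotone_of_hasDerivAt_nonneg h.hasDerivAt_leftMass fun x => sq_nonneg (u x)

theorem H1Pair.tendsto_leftMass_atBot (h : H1Pair u g) :
    Tendsto (leftMass u) atBot (𝓝 0) := by
  have := intervalIntegral_tendsto_integral_Iic 0 h.integrable_sq.integrableOn tendsto_id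
  have h2 := this.const_sub (leftMass u 0)
  simp only [leftMass, sub_self] at h2
  refine h2.congr fun x => ?_
  have := intervalIntegral.integral_Iic_sub_Iic (μ := volume) (a := x) (b := 0)
    h.integrable_sq.integrableOn h.integrable_sq.integrableOn
  simp only [leftMass, id] at *
  linarith

theorem H1Pair.leftMass_add_leftMass_neg (h : H1Pair u g) (x : ℝ) :
    leftMass u x + leftMass (fun t => u (-t)) (-x) = mass u := by
  have e : leftMass (fun t => u (-t)) (-x) = ∫ t in Ioi x, u t ^ 2 := by
    simp only [leftMass]
    rw [integral_comp_neg_Iic (-x) (fun t => u t ^ 2), neg_neg]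
  rw [e, leftMass, mass, intervalIntegral.integral_Iic_add_Ioi h.integrable_sq.integrableOn
    h.integrable_sq.integrableOn]

theorem H1Pair.tendsto_leftMass_atTop (h : H1Pair u g) :
    Tendsto (leftMass u) atTop (𝓝 (mass u)) := by
  have := (h.comp_neg.tendsto_leftMass_atBot.comp tendsto_neg_atTop_atBot).const_sub (mass u)
  rw [sub_zero] at this
  refine this.congr fun x => ?_
  simp only [Function.comp, ← h.leftMass_add_leftMass_neg x]
  ring

theorem H1Pair.exists_leftMass_eq (h : H1Pair u g) {s : ℝ} (h0 : 0 < s) (h1 : s < mass u) :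
    ∃ x, leftMass u x = s := by
  obtain ⟨a, ha⟩ := (h.tendsto_leftMass_atBot.eventually (gt_mem_nhds h0)).exists
  obtain ⟨b, hb⟩ := (h.tendsto_leftMass_atTop.eventually (lt_mem_nhds h1)).exists
  exact mem_range_of_exists_le_of_exists_ge h.continuous_leftMass ⟨a, ha.le⟩ ⟨b, hb.le⟩

/-- Such an `x` is a minimum of `leftMass u`, whose derivative is `u²`. -/
theorem H1Pair.eq_zero_of_leftMass_eq_zero (h : H1Pair u g) {x : ℝ} (hx : leftMass u x = 0) :
    u x = 0 := by
  have hmin : IsLocalMin (leftMass u) x :=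
    Eventually.of_forall fun y => hx ▸ leftMass_nonneg u y
  exact pow_eq_zero_iff two_ne_zero |>.1 (hmin.hasDerivAt_eq_zero (h.hasDerivAt_leftMass x))

theorem H1Pair.integrable_density (h : H1Pair u g) {p : ℝ} (hp2 : 2 < p) :
    Integrable (density p u g) :=
  (h.integrable_deriv_sq.div_const 2).sub ((h.integrable_rpow hp2).div_const p)

theorem H1Pair.energy_eq_integral_density (h : H1Pair u g) {p : ℝ} (hp2 : 2 < p) :
    energy p u = ∫ x, density p u g x := by
  rw [h.energy_eq]
  simp only [density]
  rw [integral_sub (h.integrable_deriv_sq.div_const 2) ((h.integrable_rpow hp2).div_const p),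
    integral_div, integral_div]
  ring

/-- The right half is written as a left half-line of the reflected function, so that estimates on
left half-lines suffice. -/
theorem H1Pair.energy_eq_add (h : H1Pair u g) {p : ℝ} (hp2 : 2 < p) (x : ℝ) :
    energy p u = (∫ t in Iic x, density p u g t) +
      ∫ t in Iic (-x), density p (fun t => u (-t)) (fun t => -g (-t)) t := by
  have e : ∫ t in Iic (-x), density p (fun t => u (-t)) (fun t => -g (-t)) t =
      ∫ t in Ioi x, density p u g t := by
    rw [← neg_neg x, ← integral_comp_neg_Iic, neg_neg]
    simp [density]
  rw [e, h.energy_eq_integral_density hp2, intervalIntegral.integral_Iic_add_Ioi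
    (h.integrable_density hp2).integrableOn (h.integrable_density hp2).integrableOn]

end leftMass

/-! ### Mass coordinate, slope and potential of a profile. -/

namespace Profile

variable {p : ℝ} {φ ψ : ℝ → ℝ}

theorem continuous (P : Profile p φ ψ) : Continuous φ := P.h1Pair.continuous

theorem continuous_deriv (P : Profile p φ ψ) : Continuous ψ :=
  continuous_iff_continuousAt.2 fun x => (P.hasDerivAt_deriv x).continuousAt

theorem deriv_odd (P : Profile p φ ψ) (t : ℝ) : ψ (-t) = -ψ t := by
  have h1 : HasDerivAt (fun x => φ (-x)) (-ψ (-t)) t := by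
    simpa [Function.comp_def] using (P.hasDerivAt (-t)).scomp t (hasDerivAt_neg t)
  have h2 : (fun x => φ (-x)) = φ := funext P.even
  rw [h2] at h1
  linarith [h1.unique (P.hasDerivAt t)]

theorem strictMono_leftMass (P : Profile p φ ψ) : StrictMono (leftMass φ) :=
  strictMono_of_hasDerivAt_pos P.h1Pair.hasDerivAt_leftMass fun x => pow_pos (P.pos x) 2

theorem leftMass_pos (P : Profile p φ ψ) (t : ℝ) : 0 < leftMass φ t :=
  (leftMass_nonneg φ (t - 1)).trans_lt (P.strictMono_leftMass (by linarith))

theorem leftMass_lt_mass (P : Profile p φ ψ) (t : ℝ) : leftMass φ t < mass φ :=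
  (P.strictMono_leftMass (show t < t + 1 by linarith)).trans_le
    (P.strictMono_leftMass.monotone.ge_of_tendsto P.h1Pair.tendsto_leftMass_atTop _)

theorem invMass_leftMass (P : Profile p φ ψ) (t : ℝ) : invMass φ (leftMass φ t) = t :=
  Function.leftInverse_invFun P.strictMono_leftMass.injective t

theorem leftMass_invMass (P : Profile p φ ψ) {s : ℝ} (h0 : 0 < s) (h1 : s < mass φ) :
    leftMass φ (invMass φ s) = s :=
  Function.invFun_eq (P.h1Pair.exists_leftMass_eq h0 h1)

theorem two_mul_leftMass_zero (P : Profile p φ ψ) : 2 * leftMass φ 0 = mass φ := by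
  have := P.h1Pair.leftMass_add_leftMass_neg 0
  simp only [P.even, neg_zero] at this
  linarith

theorem hasDerivAt_invMass (P : Profile p φ ψ) {s : ℝ} (h0 : 0 < s) (h1 : s < mass φ) :
    HasDerivAt (invMass φ) (1 / φ (invMass φ s) ^ 2) s := by
  have hev : ∀ᶠ s' in 𝓝 s, leftMass φ (invMass φ s') = s' := by
    filter_upwards [lt_mem_nhds h0, gt_mem_nhds h1] with s' h0' h1'
    exact P.leftMass_invMass h0' h1'
  have hcont : ContinuousAt (invMass φ) s := by
    have hs := P.leftMass_invMass h0 h1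
    refine tendsto_order.2 ⟨fun t ht => ?_, fun t ht => ?_⟩
    · filter_upwards [hev, lt_mem_nhds (hs ▸ P.strictMono_leftMass ht)] with s' h2 h3
      rw [← h2] at h3
      exact P.strictMono_leftMass.lt_iff_lt.1 h3
    · filter_upwards [hev, gt_mem_nhds (hs ▸ P.strictMono_leftMass ht)] with s' h2 h3
      rw [← h2] at h3
      exact P.strictMono_leftMass.lt_iff_lt.1 h3
  rw [one_div]
  exact (P.h1Pair.hasDerivAt_leftMass _).of_local_left_inverse hcont
    (pow_pos (P.pos _) 2).ne' hev

theorem hasDerivAt_slope (P : Profile p φ ψ) (t : ℝ) : HasDerivAt (slope φ ψ)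
    ((-2 * ψ t ^ 2 - (1 - 2 / p) * φ t ^ p) / (4 * φ t ^ 4)) t := by
  have h0 := (P.pos t).ne'
  have h := (P.hasDerivAt_deriv t).div (((P.hasDerivAt t).pow 3).const_mul 4)
    (by simpa using h0)
  refine h.congr_deriv ?_
  simp only [Pi.pow_apply]
  field_simp
  ring

theorem continuous_slope (P : Profile p φ ψ) : Continuous (slope φ ψ) :=
  continuous_iff_continuousAt.2 fun x => (P.hasDerivAt_slope x).continuousAt

/-- Monotonicity of the slope is what penalizes a median away from the origin in
`energy_gt_of_leftMass_lt`. -/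
theorem strictAnti_slope (P : Profile p φ ψ) (hp2 : 2 < p) : StrictAnti (slope φ ψ) := by
  refine strictAnti_of_hasDerivAt_neg P.hasDerivAt_slope fun t => ?_
  have h0 := P.pos t
  have h1 : 0 < 1 - 2 / p := by
    rw [sub_pos, div_lt_one (by linarith)]
    exact hp2
  have h2 : 0 < (1 - 2 / p) * φ t ^ p := by positivity
  exact div_neg_of_neg_of_pos (by nlinarith [sq_nonneg (ψ t)]) (by positivity)

theorem hasDerivAt_potential (P : Profile p φ ψ) (hp2 : 2 < p) (t : ℝ) :
    HasDerivAt (potential p φ) (-((6 - p) / (4 * p)) * φ t ^ p) t := by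
  have hc : Continuous fun t => |φ t| ^ p :=
    P.continuous.abs.rpow_const fun x => Or.inr (by linarith)
  have hi := P.h1Pair.integrable_rpow hp2
  have e : potential p φ = fun y => -((6 - p) / (4 * p)) *
      ((∫ t in Iic 0, |φ t| ^ p) + ∫ t in (0 : ℝ)..y, |φ t| ^ p) := by
    funext y
    have := intervalIntegral.integral_Iic_sub_Iic (μ := volume) (a := 0) (b := y)
      hi.integrableOn hi.integrableOn
    rw [potential, ← this]
    ring
  rw [e, ← abs_of_pos (P.pos t)]
  exact ((intervalIntegral.integral_hasDerivAt_right (hc.intervalIntegrable _ _)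
    (hc.stronglyMeasurableAtFilter _ _) hc.continuousAt).const_add _).const_mul _

theorem continuous_potential (P : Profile p φ ψ) (hp2 : 2 < p) : Continuous (potential p φ) :=
  continuous_iff_continuousAt.2 fun x => (P.hasDerivAt_potential hp2 x).continuousAt

theorem _root_.NLSLine.potential_nonpos (hp2 : 2 < p) (hp6 : p < 6) (φ : ℝ → ℝ) (t : ℝ) :
    potential p φ t ≤ 0 := by
  have h1 : 0 ≤ ∫ x in Iic t, |φ x| ^ p :=
    setIntegral_nonneg measurableSet_Iic fun t _ => by positivity
  have h2 : 0 ≤ (6 - p) / (4 * p) := div_nonneg (by linarith) (by linarith)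
  rw [potential, neg_mul]
  exact neg_nonpos.2 (mul_nonneg h2 h1)

end Profile

/-! ### The calibration inequality and its equality case. -/

theorem absolutelyContinuousOnInterval_of_hasDerivAt {f f' : ℝ → ℝ} {a b : ℝ} (hab : a ≤ b)
    (hf : ∀ x ∈ Icc a b, HasDerivAt f (f' x) x) (hf' : ContinuousOn f' (Icc a b)) :
    AbsolutelyContinuousOnInterval f a b := by
  obtain ⟨C, hC⟩ := isCompact_Icc.exists_bound_of_continuousOn hf'
  have hl : LipschitzOnWith C.toNNReal f (Icc a b) :=
    (convex_Icc a b).lipschitzOnWith_of_nnnorm_hasDerivWithin_le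
      (fun x hx => (hf x hx).hasDerivWithinAt) fun x hx => by
        rw [← NNReal.coe_le_coe, coe_nnnorm]
        exact (hC x hx).trans (Real.le_coe_toNNReal C)
  rw [← uIcc_of_le hab] at hl
  exact hl.absolutelyContinuousOnInterval

namespace Profile

variable {p : ℝ} {φ ψ u g : ℝ → ℝ}

/-- Completion of the square, read with `v = u`, `d = u'`, `r = φ(τ)`, `s = ψ(τ)`: the middle
bracket is the derivative of `u⁴ * slope(τ) + potential(τ)` when `τ' = v²/r²`. -/
theorem density_eq_of_defect {p v d r s : ℝ} (hp : p ≠ 0) (hr : 0 < r) :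
    d ^ 2 / 2 - |v| ^ p / p = (d - v ^ 3 * s / r ^ 3) ^ 2 / 2 + (4 * v ^ 3 * d * (s / (4 * r ^ 3)) +
      v ^ 4 * ((-2 * s ^ 2 - (1 - 2 / p) * r ^ p) / (4 * r ^ 4) * (v ^ 2 / r ^ 2)) +
      -((6 - p) / (4 * p)) * r ^ p * (v ^ 2 / r ^ 2)) + defect p v r := by
  rw [defect]
  field_simp
  ring

theorem continuousOn_defect (P : Profile p φ ψ) (hp2 : 2 < p) {s : Set ℝ} {τ : ℝ → ℝ}
    (hu : ContinuousOn u s) (hτ : ContinuousOn τ s) :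
    ContinuousOn (fun x => defect p (u x) (φ (τ x))) s := by
  have hφc : ContinuousOn (fun x => φ (τ x)) s := P.continuous.comp_continuousOn hτ
  have hφ0 : ∀ x, φ (τ x) ≠ 0 := fun x => (P.pos _).ne'
  have hφp : ContinuousOn (fun x => φ (τ x) ^ p) s := hφc.rpow_const fun x _ => Or.inl (hφ0 x)
  have hup : ContinuousOn (fun x => |u x| ^ p) s :=
    hu.abs.rpow_const fun x _ => Or.inr (by linarith)
  unfold defect
  exact ContinuousOn.sub (ContinuousOn.div_const (((hu.pow 2).mul hφp).mul
    ((continuousOn_const.mul ((hu.pow 4).div (hφc.pow 6) fun x _ => pow_ne_zero 6 (hφ0 x))).add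
      (continuousOn_const.div (hφc.pow 2) fun x _ => pow_ne_zero 2 (hφ0 x)))) _)
    (hup.div_const _)

/-- The calibration inequality on a bounded interval. -/
theorem calibration_interval (P : Profile p φ ψ) (hp2 : 2 < p) (h : H1Pair u g)
    {a b : ℝ} (hab : a ≤ b) {τ : ℝ → ℝ}
    (hτ : ∀ x ∈ Icc a b, HasDerivAt τ (u x ^ 2 / φ (τ x) ^ 2) x) :
    (u b ^ 4 * slope φ ψ (τ b) + potential p φ (τ b)) -
        (u a ^ 4 * slope φ ψ (τ a) + potential p φ (τ a)) +
        ∫ x in a..b, defect p (u x) (φ (τ x)) ≤ ∫ x in a..b, density p u g x := by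
  have hp0 : p ≠ 0 := by linarith
  have hu := h.continuous.continuousOn (s := Icc a b)
  have hτc : ContinuousOn τ (Icc a b) := fun x hx => (hτ x hx).continuousAt.continuousWithinAt
  have hφc : ContinuousOn (fun x => φ (τ x)) (Icc a b) := P.continuous.comp_continuousOn hτc
  have hψc : ContinuousOn (fun x => ψ (τ x)) (Icc a b) := P.continuous_deriv.comp_continuousOn hτc
  have hφ0 : ∀ x, φ (τ x) ≠ 0 := fun x => (P.pos _).ne'
  have hφp : ContinuousOn (fun x => φ (τ x) ^ p) (Icc a b) :=
    hφc.rpow_const fun x _ => Or.inl (hφ0 x)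
  have hτ'c : ContinuousOn (fun x => u x ^ 2 / φ (τ x) ^ 2) (Icc a b) :=
    (hu.pow 2).div (hφc.pow 2) fun x _ => pow_ne_zero 2 (hφ0 x)
  set s' : ℝ → ℝ := fun x => (-2 * ψ (τ x) ^ 2 - (1 - 2 / p) * φ (τ x) ^ p) / (4 * φ (τ x) ^ 4) *
    (u x ^ 2 / φ (τ x) ^ 2) with hs'
  set q' : ℝ → ℝ := fun x => -((6 - p) / (4 * p)) * φ (τ x) ^ p * (u x ^ 2 / φ (τ x) ^ 2) with hq'
  have hs'c : ContinuousOn s' (Icc a b) := by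
    refine ContinuousOn.mul (ContinuousOn.div ?_ ?_ fun x _ => ?_) hτ'c
    · exact (continuousOn_const.mul (hψc.pow 2)).sub (continuousOn_const.mul hφp)
    · exact continuousOn_const.mul (hφc.pow 4)
    · exact mul_ne_zero four_ne_zero (pow_ne_zero 4 (hφ0 x))
  have hq'c : ContinuousOn q' (Icc a b) := (continuousOn_const.mul hφp).mul hτ'c
  have hsd : ∀ x ∈ Icc a b, HasDerivAt (fun x => slope φ ψ (τ x)) (s' x) x := fun x hx =>
    (P.hasDerivAt_slope (τ x)).comp x (hτ x hx)
  have hqd : ∀ x ∈ Icc a b, HasDerivAt (fun x => potential p φ (τ x)) (q' x) x := fun x hx =>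
    (P.hasDerivAt_potential hp2 (τ x)).comp x (hτ x hx)
  have hsc : ContinuousOn (fun x => slope φ ψ (τ x)) (Icc a b) :=
    P.continuous_slope.comp_continuousOn hτc
  have hacs := absolutelyContinuousOnInterval_of_hasDerivAt hab hsd hs'c
  have hacu := h.absolutelyContinuous a b
  have hacu4 : AbsolutelyContinuousOnInterval (fun x => u x ^ 4) a b := by
    have := (hacu.mul hacu).mul (hacu.mul hacu)
    refine (congrArg (fun f => AbsolutelyContinuousOnInterval f a b) (funext fun x => ?_)).mp this
    simp only [Pi.mul_apply]
    ring
  have e1 : ∫ x in a..b, (4 * u x ^ 3 * g x * slope φ ψ (τ x) + u x ^ 4 * s' x) =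
      u b ^ 4 * slope φ ψ (τ b) - u a ^ 4 * slope φ ψ (τ a) := by
    rw [← hacu4.integral_deriv_mul_eq_sub hacs]
    apply intervalIntegral.integral_congr_ae
    filter_upwards [h.ae_hasDerivAt] with x hx hxI
    have hxI' : x ∈ Icc a b := by
      rw [← uIcc_of_le hab]
      exact uIoc_subset_uIcc hxI
    rw [(hsd x hxI').deriv, (hx.fun_pow 4).deriv]
    norm_num
  have e2 : ∫ x in a..b, q' x = potential p φ (τ b) - potential p φ (τ a) := by
    apply intervalIntegral.integral_eq_sub_of_hasDerivAt
    · rw [uIcc_of_le hab]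
      exact hqd
    · exact hq'c.intervalIntegrable_of_Icc hab
  have i1 : IntervalIntegrable (fun x => 4 * u x ^ 3 * g x * slope φ ψ (τ x) + u x ^ 4 * s' x)
      volume a b := by
    refine IntervalIntegrable.add (IntervalIntegrable.mul_continuousOn ?_ ?_) ?_
    · exact (intervalIntegrable_of_locallyIntegrable h.locallyIntegrable a b).continuousOn_mul
        (continuous_const.mul (h.continuous.pow 3)).continuousOn
    · rwa [uIcc_of_le hab]
    · exact ((hu.pow 4).mul hs'c).intervalIntegrable_of_Icc hab
  have i2 : IntervalIntegrable q' volume a b := hq'c.intervalIntegrable_of_Icc hab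
  have i3 : IntervalIntegrable (fun x => defect p (u x) (φ (τ x))) volume a b :=
    (P.continuousOn_defect hp2 hu hτc).intervalIntegrable_of_Icc hab
  have i4 : IntervalIntegrable (density p u g) volume a b :=
    (h.integrable_density hp2).intervalIntegrable
  calc _ = ∫ x in a..b, ((4 * u x ^ 3 * g x * slope φ ψ (τ x) + u x ^ 4 * s' x) + q' x +
        defect p (u x) (φ (τ x))) := by
        rw [intervalIntegral.integral_add (i1.add i2) i3, intervalIntegral.integral_add i1 i2,
          e1, e2]
        ring
    _ ≤ _ := by
        refine intervalIntegral.integral_mono_on hab ((i1.add i2).add i3) i4 fun x _ => ?_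
        rw [density, density_eq_of_defect (v := u x) (d := g x) (s := ψ (τ x)) hp0 (P.pos (τ x))]
        simp only [slope, hs', hq']
        linarith [sq_nonneg (g x - u x ^ 3 * ψ (τ x) / φ (τ x) ^ 3)]

theorem hasDerivAt_invMass_comp (P : Profile p φ ψ) (h : H1Pair u g) {c x : ℝ}
    (h0 : 0 < c + leftMass u x) (h1 : c + leftMass u x < mass φ) :
    HasDerivAt (fun x => invMass φ (c + leftMass u x))
      (u x ^ 2 / φ (invMass φ (c + leftMass u x)) ^ 2) x := by
  refine ((P.hasDerivAt_invMass h0 h1).comp x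
    ((h.hasDerivAt_leftMass x).const_add c)).congr_deriv ?_
  ring

/-- The calibration inequality on a half-line. -/
theorem calibration_Iic (P : Profile p φ ψ) (hp2 : 2 < p) (hp6 : p < 6) (h : H1Pair u g) {b : ℝ}
    (h0 : 0 < leftMass u b) (h1 : leftMass u b < mass φ) :
    u b ^ 4 * slope φ ψ (invMass φ (leftMass u b)) + potential p φ (invMass φ (leftMass u b)) ≤
      ∫ x in Iic b, density p u g x := by
  -- If `u` vanishes near `-∞`, the matching map is not defined there. Adding the mass `ε` keeps it
  -- in a bounded range on all of `Iic b`. The boundary term at `-∞` is then a value of `potential`,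
  -- which is nonpositive and can be dropped, and `ε → 0` at the end.
  have step : ∀ ε, 0 < ε → ε + leftMass u b < mass φ →
      u b ^ 4 * slope φ ψ (invMass φ (ε + leftMass u b)) +
        potential p φ (invMass φ (ε + leftMass u b)) ≤ ∫ x in Iic b, density p u g x := by
    intro ε hε hεb
    have hpos : ∀ x, 0 < ε + leftMass u x := fun x => by linarith [leftMass_nonneg u x]
    have hlt : ∀ x ≤ b, ε + leftMass u x < mass φ := fun x hx => by
      linarith [h.monotone_leftMass hx]
    have hT : Tendsto (fun x => invMass φ (ε + leftMass u x)) atBot (𝓝 (invMass φ ε)) := by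
      have hc : ContinuousAt (invMass φ) (ε + 0) :=
        (P.hasDerivAt_invMass (by linarith) (by linarith)).continuousAt
      have := hc.tendsto.comp (h.tendsto_leftMass_atBot.const_add ε)
      rwa [add_zero] at this
    have hlim : Tendsto (fun a => u b ^ 4 * slope φ ψ (invMass φ (ε + leftMass u b)) +
        potential p φ (invMass φ (ε + leftMass u b)) -
        (u a ^ 4 * slope φ ψ (invMass φ (ε + leftMass u a)) +
          potential p φ (invMass φ (ε + leftMass u a)))) atBot
        (𝓝 (u b ^ 4 * slope φ ψ (invMass φ (ε + leftMass u b)) +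
          potential p φ (invMass φ (ε + leftMass u b)) -
          (0 ^ 4 * slope φ ψ (invMass φ ε) + potential p φ (invMass φ ε)))) :=
      (((h.tendsto_atBot.pow 4).mul ((P.continuous_slope.tendsto _).comp hT)).add
        (((P.continuous_potential hp2).tendsto _).comp hT)).const_sub _
    have hint := intervalIntegral_tendsto_integral_Iic b
      (h.integrable_density hp2).integrableOn (tendsto_id (α := ℝ))
    have := le_of_tendsto_of_tendsto hlim hint <| by
      filter_upwards [eventually_le_atBot b] with a hab
      have hcal := P.calibration_interval hp2 h hab (τ := fun x => invMass φ (ε + leftMass u x))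
        fun x hx => P.hasDerivAt_invMass_comp h (hpos x) (hlt x hx.2)
      have hd : 0 ≤ ∫ x in a..b, defect p (u x) (φ (invMass φ (ε + leftMass u x))) :=
        intervalIntegral.integral_nonneg hab fun x _ => defect_nonneg hp2 hp6 (P.pos _)
      simp only [id]
      linarith
    linarith [potential_nonpos hp2 hp6 φ (invMass φ ε)]
  have hT : Tendsto (fun ε => invMass φ (ε + leftMass u b)) (𝓝[>] 0)
      (𝓝 (invMass φ (leftMass u b))) := by
    have hc : ContinuousAt (fun ε => invMass φ (ε + leftMass u b)) 0 := by
      have hc : ContinuousAt (invMass φ) (0 + leftMass u b) :=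
        (P.hasDerivAt_invMass (by linarith) (by linarith)).continuousAt
      exact ContinuousAt.comp (f := fun ε => ε + leftMass u b) hc
        (continuousAt_id.add continuousAt_const)
    have := hc.tendsto
    rw [zero_add] at this
    exact this.mono_left nhdsWithin_le_nhds
  refine le_of_tendsto ((((P.continuous_slope.tendsto _).comp hT).const_mul (u b ^ 4)).add
    (((P.continuous_potential hp2).tendsto _).comp hT)) ?_
  have : ∀ᶠ ε in 𝓝[>] (0 : ℝ), ε < mass φ - leftMass u b :=
    nhdsWithin_le_nhds (gt_mem_nhds (by linarith))
  filter_upwards [self_mem_nhdsWithin, this] with ε hε hε'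
  exact step ε hε (by linarith)

/-- Subtracting the half-line inequality at `a` leaves a nonpositive integral of the nonnegative
continuous defect over `[a, b]`, so the defect vanishes at `a`. -/
theorem eq_zero_or_sq_eq_of_calibration_Iic_le (P : Profile p φ ψ) (hp2 : 2 < p) (hp6 : p < 6)
    (h : H1Pair u g) {b : ℝ} (h1 : leftMass u b < mass φ)
    (hle : ∫ x in Iic b, density p u g x ≤
      u b ^ 4 * slope φ ψ (invMass φ (leftMass u b)) + potential p φ (invMass φ (leftMass u b)))
    {a : ℝ} (hab : a < b) (ha : 0 < leftMass u a) :
    u a = 0 ∨ u a ^ 2 = φ (invMass φ (leftMass u a)) ^ 2 := by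
  have hτ : ∀ x ∈ Icc a b, HasDerivAt (fun x => invMass φ (leftMass u x))
      (u x ^ 2 / φ (invMass φ (leftMass u x)) ^ 2) x := fun x hx => by
    have h2 := h.monotone_leftMass hx.1
    have h3 := h.monotone_leftMass hx.2
    simpa using P.hasDerivAt_invMass_comp h (c := 0) (x := x) (by linarith) (by linarith)
  have hcal := P.calibration_interval hp2 h hab.le hτ
  have hleft := P.calibration_Iic hp2 hp6 h ha
    ((h.monotone_leftMass hab.le).trans_lt h1)
  have hsub := intervalIntegral.integral_Iic_sub_Iic (μ := volume) (a := a) (b := b)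
    (h.integrable_density hp2).integrableOn (h.integrable_density hp2).integrableOn
  have hd : ∫ x in a..b, defect p (u x) (φ (invMass φ (leftMass u x))) ≤ 0 := by linarith
  have hc := P.continuousOn_defect hp2 (h.continuous.continuousOn (s := Icc a b))
    fun x hx => (hτ x hx).continuousAt.continuousWithinAt
  have hnn : ∀ x, 0 ≤ defect p (u x) (φ (invMass φ (leftMass u x))) :=
    fun x => defect_nonneg hp2 hp6 (P.pos _)
  refine eq_zero_or_sq_eq_of_defect_eq_zero hp2 hp6 (P.pos _) (le_antisymm ?_ (hnn a))
  by_contra! hpos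
  have := intervalIntegral.integral_pos hab hc (fun x _ => hnn x) ⟨a, left_mem_Icc.2 hab.le, hpos⟩
  linarith

/-- Equality in the calibration inequality on a half-line forces `u` to be a translate of the
profile, up to sign. -/
theorem sq_eq_of_calibration_Iic_le (P : Profile p φ ψ) (hp2 : 2 < p) (hp6 : p < 6)
    (h : H1Pair u g) {b : ℝ} (h0 : 0 < leftMass u b) (h1 : leftMass u b < mass φ)
    (hle : ∫ x in Iic b, density p u g x ≤
      u b ^ 4 * slope φ ψ (invMass φ (leftMass u b)) + potential p φ (invMass φ (leftMass u b)))
    {x : ℝ} (hx : x ≤ b) : u x ^ 2 = φ (invMass φ (leftMass u b) - (b - x)) ^ 2 := by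
  -- The set where the matching map is defined; that it is the whole half-line is shown only at the
  -- end.
  set J : Set ℝ := {x | x ≤ b ∧ 0 < leftMass u x} with hJ
  have hJlt : ∀ x ∈ J, leftMass u x < mass φ := fun x hx =>
    (h.monotone_leftMass hx.1).trans_lt h1
  have hJconn : IsPreconnected J := by
    have : OrdConnected J := ⟨fun x hx y hy z hz =>
      ⟨hz.2.trans hy.1, hx.2.trans_le (h.monotone_leftMass hz.1)⟩⟩
    exact this.isPreconnected
  have hbJ : b ∈ J := ⟨le_rfl, h0⟩
  have hτ : ∀ x ∈ J, HasDerivAt (fun x => invMass φ (leftMass u x))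
      (u x ^ 2 / φ (invMass φ (leftMass u x)) ^ 2) x := fun x hx => by
    simpa using P.hasDerivAt_invMass_comp h (c := 0) (x := x) (by linarith [hx.2])
      (by linarith [hJlt x hx])
  set f : ℝ → ℝ := fun x => u x ^ 2 / φ (invMass φ (leftMass u x)) ^ 2 with hf
  have hfc : ContinuousOn f J :=
    (h.continuous.continuousOn.pow 2).div
      ((P.continuous.comp_continuousOn
        fun x hx => (hτ x hx).continuousAt.continuousWithinAt).pow 2)
      fun x _ => pow_ne_zero 2 (P.pos _).ne'
  have hf01' : ∀ x ∈ J, x < b → f x = 0 ∨ f x = 1 := by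
    intro x hx hxb
    rcases P.eq_zero_or_sq_eq_of_calibration_Iic_le hp2 hp6 h h1 hle hxb hx.2 with h2 | h2
    · left
      simp [hf, h2]
    · right
      simp only [hf]
      rw [h2, div_self (pow_ne_zero 2 (P.pos _).ne')]
  obtain ⟨x₁, hx₁J, hx₁b, hx₁⟩ : ∃ x ∈ J, x < b ∧ u x ≠ 0 := by
    by_contra! hc
    have hz : ∀ x, x < b → u x = 0 := fun x hx => by
      by_cases hxJ : x ∈ J
      · exact hc x hxJ hx
      · refine h.eq_zero_of_leftMass_eq_zero (le_antisymm ?_ (leftMass_nonneg u x))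
        by_contra! h3
        exact hxJ ⟨hx.le, h3⟩
    have : leftMass u b = 0 := by
      rw [leftMass, integral_Iic_eq_integral_Iio]
      refine setIntegral_eq_zero_of_forall_eq_zero fun x hx => ?_
      rw [hz x hx]
      norm_num
    linarith
  have hf1 : ∀ x ∈ J, x < b → f x = 1 := by
    intro x hx hxb
    -- The derivative `f` of the matching map is continuous with values in `{0, 1}` on a connected
    -- set and equals 1 at `x₁`; otherwise it would take the value `1 / 2`.
    refine (hf01' x hx hxb).resolve_left fun hx0 => ?_
    have hx₁1 : f x₁ = 1 := (hf01' x₁ hx₁J hx₁b).resolve_left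
      (div_ne_zero (pow_ne_zero 2 hx₁) (pow_ne_zero 2 (P.pos _).ne'))
    have hconn : IsPreconnected (J ∩ Iio b) := by
      have : OrdConnected (J ∩ Iio b) := ⟨fun x hx y hy z hz =>
        ⟨⟨hz.2.trans hy.1.1, hx.1.2.trans_le (h.monotone_leftMass hz.1)⟩, hz.2.trans_lt hy.2⟩⟩
      exact this.isPreconnected
    obtain ⟨z, hz, hz'⟩ := hconn.intermediate_value ⟨hx, hxb⟩ ⟨hx₁J, hx₁b⟩
      (hfc.mono inter_subset_left)
      (show (1 / 2 : ℝ) ∈ Icc (f x) (f x₁) by rw [hx0, hx₁1]; norm_num)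
    rcases hf01' z hz.1 hz.2 with h3 | h3 <;> rw [h3] at hz' <;> norm_num at hz'
  have hTeq : ∀ x ∈ J, invMass φ (leftMass u x) = invMass φ (leftMass u b) - (b - x) := by
    intro x hx
    rcases hx.1.eq_or_lt with rfl | hxb
    · ring
    have hIcc : ∀ z ∈ Icc x b, z ∈ J := fun z hz =>
      ⟨hz.2, hx.2.trans_le (h.monotone_leftMass hz.1)⟩
    obtain ⟨z, hz, hz'⟩ := exists_hasDerivAt_eq_slope (fun x => invMass φ (leftMass u x)) f hxb
      (fun z hz => (hτ z (hIcc z hz)).continuousAt.continuousWithinAt)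
      fun z hz => hτ z (hIcc z (Ioo_subset_Icc_self hz))
    rw [hf1 z (hIcc z (Ioo_subset_Icc_self hz)) hz.2, eq_comm,
      div_eq_one_iff_eq (by linarith)] at hz'
    linarith
  have hJall : ∀ x ≤ b, x ∈ J := by
    intro x hx
    by_contra hxJ
    have hx0 : leftMass u x = 0 := by
      refine le_antisymm ?_ (leftMass_nonneg u x)
      by_contra! h3
      exact hxJ ⟨hx, h3⟩
    -- On `J` the matching map is a translation, so `leftMass u` is at least `δ` there. If it
    -- vanished at `x` it would skip the value `δ / 2`, against continuity.
    set δ := leftMass φ (invMass φ (leftMass u b) - (b - x)) with hδ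
    have hδ0 : 0 < δ := P.leftMass_pos _
    have hge : ∀ z ∈ J, δ ≤ leftMass u z := by
      intro z hz
      have hxz : x ≤ z := by
        by_contra! h3
        have := h.monotone_leftMass h3.le
        linarith [hz.2]
      rw [← P.leftMass_invMass hz.2 (hJlt z hz), hTeq z hz]
      exact P.strictMono_leftMass.monotone (by linarith)
    obtain ⟨z, hz, hz'⟩ := intermediate_value_Icc hx h.continuous_leftMass.continuousOn
      (show δ / 2 ∈ Icc (leftMass u x) (leftMass u b) from
        ⟨by linarith, by linarith [hge b hbJ]⟩)
    have := hge z ⟨hz.2, by linarith⟩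
    linarith
  have hlt : ∀ x < b, u x ^ 2 = φ (invMass φ (leftMass u b) - (b - x)) ^ 2 := by
    intro x hx
    have h2 := hf1 x (hJall x hx.le) hx
    simp only [hf] at h2
    rw [div_eq_one_iff_eq (pow_ne_zero 2 (P.pos _).ne')] at h2
    rw [h2, hTeq x (hJall x hx.le)]
  have hcl : IsClosed {x | u x ^ 2 = φ (invMass φ (leftMass u b) - (b - x)) ^ 2} :=
    isClosed_eq (h.continuous.pow 2)
      ((P.continuous.comp (continuous_const.sub (continuous_const.sub continuous_id))).pow 2)
  have hsub : Iic b ⊆ {x | u x ^ 2 = φ (invMass φ (leftMass u b) - (b - x)) ^ 2} := by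
    rw [← closure_Iio]
    exact hcl.closure_subset_iff.2 fun x hx => hlt x hx
  exact hsub hx

end Profile

/-! ### Energy bounds at the median of the mass. -/

namespace Profile

variable {p : ℝ} {φ ψ u g : ℝ → ℝ}

theorem deriv_zero (P : Profile p φ ψ) : ψ 0 = 0 := by
  have := P.deriv_odd 0
  rw [neg_zero] at this
  linarith

theorem slope_pos (P : Profile p φ ψ) {y : ℝ} (hy : 0 < y) : 0 < slope φ ψ (-y) := by
  have h1 := P.pos (-y)
  have h2 := P.deriv_neg y hy
  rw [slope, P.deriv_odd]
  exact div_pos (by linarith) (by positivity)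

theorem slope_zero (P : Profile p φ ψ) : slope φ ψ 0 = 0 := by
  rw [slope, P.deriv_zero, zero_div]

theorem strictAntiOn (P : Profile p φ ψ) : StrictAntiOn φ (Ici 0) :=
  strictAntiOn_of_deriv_neg (convex_Ici 0) P.continuous.continuousOn fun x hx => by
    rw [interior_Ici] at hx
    rw [(P.hasDerivAt x).deriv]
    exact P.deriv_neg x hx

theorem apply_abs (P : Profile p φ ψ) (x : ℝ) : φ |x| = φ x := by
  rcases abs_choice x with h | h <;> rw [h]
  exact P.even x

theorem eq_of_apply_eq (P : Profile p φ ψ) {x y : ℝ} (hx : 0 ≤ x) (hy : 0 ≤ y) (h : φ x = φ y) :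
    x = y :=
  P.strictAntiOn.injOn hx hy h

theorem tendsto_atTop (P : Profile p φ ψ) : Tendsto φ atTop (𝓝 0) := by
  refine (P.h1Pair.tendsto_atBot.comp tendsto_neg_atTop_atBot).congr fun x => ?_
  exact P.even x

theorem mass_pos (P : Profile p φ ψ) : 0 < mass φ := (P.leftMass_pos 0).trans (P.leftMass_lt_mass 0)

/-- The lower bound for the energy in terms of the value at the median of the mass. -/
theorem energy_ge (P : Profile p φ ψ) (hp2 : 2 < p) (hp6 : p < 6) (h : H1Pair u g) {x₁ y : ℝ}
    (hm : mass u = 2 * leftMass φ (-y)) (hx₁ : leftMass u x₁ = leftMass φ (-y)) :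
    2 * (u x₁ ^ 4 * slope φ ψ (-y) + potential p φ (-y)) ≤ energy p u := by
  have h1 := P.leftMass_pos (-y)
  have h2 := P.leftMass_lt_mass (-y)
  have hr : leftMass (fun t => u (-t)) (-x₁) = leftMass φ (-y) := by
    linarith [h.leftMass_add_leftMass_neg x₁]
  have hl := P.calibration_Iic hp2 hp6 h (b := x₁) (hx₁ ▸ h1) (hx₁ ▸ h2)
  have hr' := P.calibration_Iic hp2 hp6 h.comp_neg (b := -x₁) (hr ▸ h1) (hr ▸ h2)
  rw [hx₁, P.invMass_leftMass] at hl
  rw [hr, P.invMass_leftMass, neg_neg] at hr'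
  rw [h.energy_eq_add hp2 x₁]
  linarith

theorem sq_eq_of_energy_le (P : Profile p φ ψ) (hp2 : 2 < p) (hp6 : p < 6) (h : H1Pair u g)
    {x₁ y : ℝ} (hm : mass u = 2 * leftMass φ (-y)) (hx₁ : leftMass u x₁ = leftMass φ (-y))
    (hle : energy p u ≤ 2 * (u x₁ ^ 4 * slope φ ψ (-y) + potential p φ (-y))) (x : ℝ) :
    u x ^ 2 = φ (|x - x₁| + y) ^ 2 := by
  have h1 := P.leftMass_pos (-y)
  have h2 := P.leftMass_lt_mass (-y)
  have hr : leftMass (fun t => u (-t)) (-x₁) = leftMass φ (-y) := by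
    linarith [h.leftMass_add_leftMass_neg x₁]
  have hl := P.calibration_Iic hp2 hp6 h (b := x₁) (hx₁ ▸ h1) (hx₁ ▸ h2)
  have hr' := P.calibration_Iic hp2 hp6 h.comp_neg (b := -x₁) (hr ▸ h1) (hr ▸ h2)
  have hl2 := P.sq_eq_of_calibration_Iic_le hp2 hp6 h (b := x₁) (hx₁ ▸ h1) (hx₁ ▸ h2)
  have hr2 := P.sq_eq_of_calibration_Iic_le hp2 hp6 h.comp_neg (b := -x₁) (hr ▸ h1) (hr ▸ h2)
  rw [hx₁, P.invMass_leftMass] at hl hl2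
  rw [hr, P.invMass_leftMass, neg_neg] at hr' hr2
  rw [h.energy_eq_add hp2 x₁] at hle
  rcases le_total x x₁ with hx | hx
  · rw [hl2 (by linarith) hx, abs_of_nonpos (by linarith), ← P.even]
    ring_nf
  · have := hr2 (by linarith) (x := -x) (by linarith)
    rw [neg_neg] at this
    rw [this, abs_of_nonneg (by linarith), ← P.even]
    ring_nf

/-- The profile never vanishes, so a continuous `u` cannot change sign. -/
theorem eq_or_eq_neg_of_sq_eq (P : Profile p φ ψ) (hu : Continuous u) {f : ℝ → ℝ}
    (hf : Continuous f) (h : ∀ x, u x ^ 2 = φ (f x) ^ 2) :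
    (u = fun x => φ (f x)) ∨ (u = fun x => -φ (f x)) := by
  have := isPreconnected_univ.eq_or_eq_neg_of_sq_eq hu.continuousOn
    (P.continuous.comp hf).continuousOn (fun x _ => h x) fun {x} _ => (P.pos (f x)).ne'
  rcases this with h | h
  · exact Or.inl (funext fun x => h (mem_univ x))
  · exact Or.inr (funext fun x => h (mem_univ x))

/-! ### Profiles, their translates and cut profiles as competitors. -/

/-- The energy of a profile on a half-line. -/
theorem integral_Iic_density (P : Profile p φ ψ) (hp2 : 2 < p) (t : ℝ) :
    ∫ x in Iic t, density p φ ψ x = φ t ^ 4 * slope φ ψ t + potential p φ t := by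
  have hp0 : p ≠ 0 := by linarith
  -- By the stationary equation this is a primitive of the energy density minus the integrand of
  -- `potential`, so the profile itself attains equality in the calibration.
  have hd : ∀ x, HasDerivAt (fun x => φ x * ψ x / 4)
      (density p φ ψ x + (6 - p) / (4 * p) * |φ x| ^ p) x := fun x => by
    refine (((P.hasDerivAt x).mul (P.hasDerivAt_deriv x)).div_const 4).congr_deriv ?_
    have := (P.pos x).ne'
    rw [density, abs_of_pos (P.pos x)]
    field_simp
    ring
  have hi1 := (P.h1Pair.integrable_density hp2).integrableOn (s := Iic t)
  have hi2 : IntegrableOn (fun x => (6 - p) / (4 * p) * |φ x| ^ p) (Iic t) :=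
    ((P.h1Pair.integrable_rpow hp2).const_mul _).integrableOn
  have hlim : Tendsto (fun x => φ x * ψ x / 4) atBot (𝓝 0) := by
    obtain ⟨C, hC⟩ := P.exists_abs_deriv_le
    have h0 : Tendsto (fun x => C * φ x ^ 2 / 4) atBot (𝓝 0) := by
      simpa using (((P.h1Pair.tendsto_atBot.pow 2).const_mul C).div_const 4)
    refine squeeze_zero_norm (fun x => ?_) h0
    rw [Real.norm_eq_abs, abs_div, abs_mul, abs_of_pos (P.pos x), abs_of_pos (by norm_num : (0:ℝ) < 4)]
    have := mul_le_mul_of_nonneg_left (hC x) (P.pos x).le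
    linarith
  have := integral_Iic_of_hasDerivAt_of_tendsto' (fun x _ => hd x) (hi1.add hi2) hlim
  rw [integral_add hi1 hi2, integral_const_mul] at this
  have e : φ t ^ 4 * slope φ ψ t = φ t * ψ t / 4 := by
    have := (P.pos t).ne'
    rw [slope]
    field_simp
  rw [e, potential]
  linarith

theorem _root_.NLSLine.integrable_comp_abs_add {f : ℝ → ℝ} (hf : Integrable f) (y : ℝ) :
    Integrable fun x => f (|x| + y) := by
  rw [← integrableOn_univ, ← Iic_union_Ioi (a := (0 : ℝ))]
  refine IntegrableOn.union ?_ ?_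
  · refine (((hf.comp_add_right y).comp_neg).integrableOn (s := Iic 0)).congr_fun
      (fun x hx => ?_) measurableSet_Iic
    rw [abs_of_nonpos hx]
  · refine ((hf.comp_add_right y).integrableOn (s := Ioi 0)).congr_fun
      (fun x hx => ?_) measurableSet_Ioi
    rw [abs_of_pos hx]

/-- The profile with a piece of width `2 * y` around the origin removed. -/
theorem h1Pair_abs (P : Profile p φ ψ) (y : ℝ) :
    H1Pair (fun x => φ (|x| + y)) (fun x => SignType.sign x * ψ (|x| + y)) := by
  have hcφ : Continuous fun x => φ (|x| + y) :=
    P.continuous.comp (continuous_abs.add continuous_const)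
  have hcψ : Continuous fun x => ψ (|x| + y) :=
    P.continuous_deriv.comp (continuous_abs.add continuous_const)
  have hsm : Measurable fun x : ℝ => ((SignType.sign x : SignType) : ℝ) := by
    have : (fun x : ℝ => ((SignType.sign x : SignType) : ℝ)) =
        fun x => if 0 < x then 1 else if x < 0 then -1 else 0 := by
      funext x
      rcases lt_trichotomy x 0 with h | h | h
      · simp [h, h.not_gt]
      · simp [h]
      · simp [h]
    rw [this]
    exact Measurable.ite measurableSet_Ioi measurable_const
      (Measurable.ite measurableSet_Iio measurable_const measurable_const)
  have h1 : MemLp (fun x => φ (|x| + y)) 2 volume :=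
    (memLp_two_iff_integrable_sq hcφ.aestronglyMeasurable).2
      (integrable_comp_abs_add P.h1Pair.integrable_sq y)
  have h2' : MemLp (fun x => ψ (|x| + y)) 2 volume :=
    (memLp_two_iff_integrable_sq hcψ.aestronglyMeasurable).2
      (integrable_comp_abs_add P.h1Pair.integrable_deriv_sq y)
  have h2 : MemLp (fun x => SignType.sign x * ψ (|x| + y)) 2 volume := by
    refine h2'.mono (hsm.aestronglyMeasurable.mul hcψ.aestronglyMeasurable)
      (Eventually.of_forall fun x => ?_)
    rw [norm_mul]
    refine mul_le_of_le_one_left (norm_nonneg _) ?_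
    rcases lt_trichotomy x 0 with h | h | h <;> simp [h]
  have hloc := memLp_two_locallyIntegrable h2
  refine ⟨⟨hloc, fun a b => ?_⟩, h1, h2⟩
  refine (integral_eq_of_hasDerivAt_off_countable _ _ (countable_singleton (0 : ℝ))
    hcφ.continuousOn (fun x hx => ?_) (intervalIntegrable_of_locallyIntegrable hloc a b)).symm
  have hx0 : x ≠ 0 := hx.2
  have := (P.hasDerivAt (|x| + y)).comp x ((hasDerivAt_abs hx0).add_const y)
  rwa [mul_comm] at this

theorem _root_.NLSLine.setIntegral_Iic_comp_sub (f : ℝ → ℝ) (y : ℝ) :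
    ∫ t in Iic 0, f (t - y) = ∫ t in Iic (-y), f t := by
  have := (measurePreserving_sub_right volume y).setIntegral_preimage_emb
    (measurableEmbedding_subRight y) f (Iic (-y))
  rw [← this]
  simp

theorem leftMass_abs (φ : ℝ → ℝ) (hφ : ∀ t, φ (-t) = φ t) (y : ℝ) :
    leftMass (fun x => φ (|x| + y)) 0 = leftMass φ (-y) := by
  have e : leftMass φ (-y) = ∫ t in Iic 0, φ (t - y) ^ 2 := by
    rw [leftMass, ← setIntegral_Iic_comp_sub]
  rw [e, leftMass]
  refine setIntegral_congr_fun measurableSet_Iic fun x hx => ?_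
  rw [abs_of_nonpos hx, ← hφ]
  ring_nf

theorem mass_abs (P : Profile p φ ψ) (y : ℝ) :
    mass (fun x => φ (|x| + y)) = 2 * leftMass φ (-y) := by
  have := (P.h1Pair_abs y).leftMass_add_leftMass_neg 0
  simp only [abs_neg, neg_zero, leftMass_abs φ P.even] at this
  linarith

/-- By symmetry this is twice the energy of the profile on `Iic (-y)`; it matches the lower bound in
`energy_ge` when `u x₁ = φ y`. -/
theorem energy_abs (P : Profile p φ ψ) (hp2 : 2 < p) (y : ℝ) :
    energy p (fun x => φ (|x| + y)) = 2 * (φ y ^ 4 * slope φ ψ (-y) + potential p φ (-y)) := by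
  have e : ∫ t in Iic 0, density p (fun x => φ (|x| + y))
      (fun x => SignType.sign x * ψ (|x| + y)) t = ∫ t in Iic (-y), density p φ ψ t := by
    rw [← setIntegral_Iic_comp_sub, integral_Iic_eq_integral_Iio, integral_Iic_eq_integral_Iio]
    refine setIntegral_congr_fun measurableSet_Iio fun x hx => ?_
    have hx' : x < 0 := hx
    have h1 : |x| + y = -(x - y) := by rw [abs_of_neg hx']; ring
    simp only [density, h1, P.even, P.deriv_odd, sign_neg hx']
    simp
  have h2 := (P.h1Pair_abs y).energy_eq_add hp2 0
  have e3 : ∫ t in Iic (-0), density p (fun t => φ (|(-t)| + y))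
      (fun t => -(SignType.sign (-t) * ψ (|(-t)| + y))) t =
      ∫ t in Iic 0, density p (fun x => φ (|x| + y))
      (fun x => SignType.sign x * ψ (|x| + y)) t := by
    rw [neg_zero]
    refine setIntegral_congr_fun measurableSet_Iic fun x hx => ?_
    simp [density, Left.sign_neg]
  rw [h2, e3, e, P.integral_Iic_density hp2, P.even]
  ring

theorem _root_.NLSLine.H1Pair.comp_add_right (h : H1Pair u g) (c : ℝ) :
    H1Pair (fun x => u (x + c)) (fun x => g (x + c)) := by
  have hg : MemLp (fun x => g (x + c)) 2 volume :=
    h.memLp_deriv.comp_measurePreserving (measurePreserving_add_right volume c)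
  refine ⟨⟨memLp_two_locallyIntegrable hg, fun x y => ?_⟩,
    h.memLp.comp_measurePreserving (measurePreserving_add_right volume c), hg⟩
  rw [h.sub_eq, intervalIntegral.integral_comp_add_right]

theorem _root_.NLSLine.mass_comp_add_right (u : ℝ → ℝ) (c : ℝ) :
    mass (fun x => u (x + c)) = mass u :=
  integral_add_right_eq_self (fun x => u x ^ 2) c

theorem _root_.NLSLine.H1Pair.energy_comp_add_right (h : H1Pair u g) (p c : ℝ) :
    energy p (fun x => u (x + c)) = energy p u := by
  rw [(h.comp_add_right c).energy_eq, h.energy_eq,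
    integral_add_right_eq_self (fun x => g x ^ 2) c,
    integral_add_right_eq_self (fun x => |u x| ^ p) c]

/-! ### Minimization under the mass constraint alone. -/

theorem energy_eq (P : Profile p φ ψ) (hp2 : 2 < p) : energy p φ = 2 * potential p φ 0 := by
  have := P.energy_abs hp2 0
  simpa [P.apply_abs, P.slope_zero] using this

theorem mem_H1Mass (P : Profile p φ ψ) : φ ∈ H1Mass (mass φ) := ⟨P.h1Pair.memH1, rfl⟩

theorem isMinOn (P : Profile p φ ψ) (hp2 : 2 < p) (hp6 : p < 6) :
    IsMinOn (energy p) (H1Mass (mass φ)) φ := by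
  rintro u ⟨hu, hm⟩
  have h := hu.h1Pair
  have h2 := P.two_mul_leftMass_zero
  obtain ⟨x₁, hx₁⟩ := h.exists_leftMass_eq (P.leftMass_pos 0) (by linarith [P.mass_pos])
  have := P.energy_ge hp2 hp6 h (y := 0) (by rw [neg_zero]; linarith) (by rw [neg_zero]; exact hx₁)
  rw [neg_zero, P.slope_zero] at this
  show energy p φ ≤ energy p u
  rw [P.energy_eq hp2]
  linarith

/-- The equality case at the median with `y = 0`. It yields both the uniqueness of the soliton and
the solutions of (P) for small `a`. -/
theorem eq_translate_of_energy_le (P : Profile p φ ψ) (hp2 : 2 < p) (hp6 : p < 6)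
    (hu : u ∈ H1Mass (mass φ)) (hle : energy p u ≤ energy p φ) :
    ∃ c, (u = fun x => φ (x - c)) ∨ (u = fun x => -φ (x - c)) := by
  have h := hu.1.h1Pair
  have h2 := P.two_mul_leftMass_zero
  have hm := hu.2
  obtain ⟨x₁, hx₁⟩ := h.exists_leftMass_eq (P.leftMass_pos 0) (by linarith [P.mass_pos])
  have := P.sq_eq_of_energy_le hp2 hp6 h (y := 0) (by rw [neg_zero]; linarith)
    (by rw [neg_zero]; exact hx₁) (by
      rw [neg_zero, P.slope_zero]
      linarith [P.energy_eq hp2])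
  simp only [add_zero, P.apply_abs] at this
  exact ⟨x₁, P.eq_or_eq_neg_of_sq_eq h.continuous (continuous_id.sub continuous_const) this⟩

theorem isSoliton (P : Profile p φ ψ) (hp2 : 2 < p) (hp6 : p < 6) : IsSoliton p (mass φ) φ :=
  ⟨P.mem_H1Mass, P.isMinOn hp2 hp6, P.pos, P.even⟩

theorem eq_of_isSoliton (P : Profile p φ ψ) (hp2 : 2 < p) (hp6 : p < 6) {f : ℝ → ℝ}
    (hf : IsSoliton p (mass φ) f) : f = φ := by
  obtain ⟨c, rfl | rfl⟩ := P.eq_translate_of_energy_le hp2 hp6 hf.mem (hf.isMin P.mem_H1Mass)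
  -- Evenness at `c` gives `φ (2c) = φ 0` up to reflection, hence `c = 0`.
  · have := hf.even c
    simp only [sub_self] at this
    rw [← P.apply_abs] at this
    have := P.eq_of_apply_eq (abs_nonneg _) le_rfl this
    have hc : c = 0 := by linarith [abs_eq_zero.1 this]
    simp [hc]
  · have := hf.pos 0
    linarith [P.pos (0 - c)]

theorem soliton_mass (P : Profile p φ ψ) (hp2 : 2 < p) (hp6 : p < 6) :
    soliton p (mass φ) = φ :=
  P.eq_of_isSoliton hp2 hp6 (Classical.epsilon_spec (p := IsSoliton p (mass φ))
    ⟨φ, P.isSoliton hp2 hp6⟩)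

/-- The solutions of the problem with value `φ y` at the origin and the mass of the profile. -/
theorem solutions_mass (P : Profile p φ ψ) (hp2 : 2 < p) (hp6 : p < 6) {y : ℝ} (hy : 0 ≤ y) :
    solutions p (mass φ) (φ y) = {fun x => φ (x + y), fun x => φ (x - y)} := by
  have hmem : ∀ c, φ c = φ y → (fun x => φ (x + c)) ∈ solutions p (mass φ) (φ y) := by
    refine fun c hc => ⟨⟨(P.h1Pair.comp_add_right c).memH1, mass_comp_add_right φ c, ?_⟩, ?_⟩
    · simpa using hc
    · rintro u ⟨hu, hm, -⟩
      show energy p (fun x => φ (x + c)) ≤ energy p u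
      rw [P.h1Pair.energy_comp_add_right]
      exact P.isMinOn hp2 hp6 ⟨hu, hm⟩
  ext u
  constructor
  · rintro ⟨⟨hu, hm, ha⟩, hmin⟩
    have hle : energy p u ≤ energy p φ := by
      rw [← P.h1Pair.energy_comp_add_right p y]
      exact hmin (hmem y rfl).1
    obtain ⟨c, rfl | rfl⟩ := P.eq_translate_of_energy_le hp2 hp6 ⟨hu, hm⟩ hle
    · simp only [zero_sub] at ha
      rw [← P.apply_abs] at ha
      have := P.eq_of_apply_eq (abs_nonneg _) hy ha
      rw [abs_neg] at this
      rcases (abs_eq hy).1 this with rfl | rfl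
      · exact Or.inr rfl
      · left
        funext x
        rw [sub_neg_eq_add]
    · linarith [P.pos (0 - c), P.pos y]
  · rintro (rfl | rfl)
    · exact hmem y rfl
    · exact hmem (-y) (P.even y)

/-! ### The problem with a large value at the origin. -/

/-- A function whose median does not lie at the origin has too much energy. -/
theorem energy_gt_of_leftMass_lt (P : Profile p φ ψ) (hp2 : 2 < p) (hp6 : p < 6) (h : H1Pair u g)
    {y : ℝ} (hy : 0 < y) (hm : mass u = 2 * leftMass φ (-y)) (h0 : u 0 = φ y)
    (hlt : leftMass u 0 < leftMass φ (-y)) :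
    2 * (φ y ^ 4 * slope φ ψ (-y) + potential p φ (-y)) < energy p u := by
  have hφy := P.pos y
  have hslope := P.slope_pos hy
  have hpos := P.leftMass_pos (-y)
  have hltm := P.leftMass_lt_mass (-y)
  obtain ⟨x₁, hx₁⟩ := h.exists_leftMass_eq hpos (by linarith)
  have hx₁0 : 0 < x₁ := by
    by_contra! hc
    linarith [h.monotone_leftMass hc]
  -- If `|u|` at the median is at least `φ y`, the median bound suffices: equality would give `φ y =
  -- φ (x₁ + y)`. Otherwise the interval `[0, x₁]` is calibrated separately.
  rcases le_or_gt (φ y ^ 4) (u x₁ ^ 4) with hc | hc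
  · have hge := P.energy_ge hp2 hp6 h hm hx₁
    have hge' : φ y ^ 4 * slope φ ψ (-y) ≤ u x₁ ^ 4 * slope φ ψ (-y) := by gcongr
    by_contra! hle
    have := P.sq_eq_of_energy_le hp2 hp6 h hm hx₁ (by linarith) 0
    rw [h0, zero_sub, abs_neg, abs_of_pos hx₁0] at this
    have := (pow_left_inj₀ hφy.le (P.pos _).le two_ne_zero).1 this
    have := P.eq_of_apply_eq hy.le (by linarith) this
    linarith
  · have hs0 : 0 < leftMass u 0 := by
      refine (leftMass_nonneg u 0).lt_of_ne' fun hz => ?_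
      linarith [h.eq_zero_of_leftMass_eq_zero hz]
    have hr : leftMass (fun t => u (-t)) (-x₁) = leftMass φ (-y) := by
      linarith [h.leftMass_add_leftMass_neg x₁]
    have hr0 : leftMass (fun t => u (-t)) 0 = 2 * leftMass φ (-y) - leftMass u 0 := by
      have := h.leftMass_add_leftMass_neg 0
      rw [neg_zero] at this
      linarith
    have hleft := P.calibration_Iic hp2 hp6 h hs0 (by linarith)
    have hright := P.calibration_Iic hp2 hp6 h.comp_neg (b := -x₁) (hr ▸ hpos) (hr ▸ hltm)
    -- The middle piece is traversed backwards, from `x₁` to 0. The shift `c` makes its map start at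
    -- `invMass φ (leftMass u 0)`, where the left piece ended, and end at `-y`.
    set c := leftMass u 0 - leftMass φ (-y) with hcdef
    have hmid := P.calibration_interval hp2 h.comp_neg (a := -x₁) (b := 0) (by linarith)
      (τ := fun x => invMass φ (c + leftMass (fun t => u (-t)) x)) fun x hx => by
        have h1 := h.comp_neg.monotone_leftMass hx.1
        have h2 := h.comp_neg.monotone_leftMass hx.2
        exact P.hasDerivAt_invMass_comp h.comp_neg (by linarith) (by linarith)
    have hd : 0 ≤ ∫ x in (-x₁)..0, defect p (u (-x))
        (φ (invMass φ (c + leftMass (fun t => u (-t)) x))) :=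
      intervalIntegral.integral_nonneg (by linarith) fun x _ => defect_nonneg hp2 hp6 (P.pos _)
    have hi := h.integrable_density (p := p) hp2
    have hmid2 : ∫ x in (-x₁)..0, density p (fun t => u (-t)) (fun t => -g (-t)) x =
        ∫ x in (0 : ℝ)..x₁, density p u g x := by
      have := intervalIntegral.integral_comp_neg (a := -x₁) (b := 0) (density p u g)
      rw [neg_zero, neg_neg] at this
      rw [← this]
      simp [density]
    have hsub := intervalIntegral.integral_Iic_sub_Iic (μ := volume) (a := 0) (b := x₁)
      hi.integrableOn hi.integrableOn
    have e1 : c + leftMass (fun t => u (-t)) (-x₁) = leftMass u 0 := by rw [hr]; ring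
    have e2 : c + leftMass (fun t => u (-t)) 0 = leftMass φ (-y) := by rw [hr0]; ring
    simp only [e1, e2, neg_zero, neg_neg, P.invMass_leftMass, h0] at hmid
    rw [hr, P.invMass_leftMass, neg_neg] at hright
    rw [h0] at hleft
    have hanti : slope φ ψ (-y) < slope φ ψ (invMass φ (leftMass u 0)) := by
      refine P.strictAnti_slope hp2 (P.strictMono_leftMass.lt_iff_lt.1 ?_)
      rwa [P.leftMass_invMass hs0 (by linarith)]
    -- The three bounds add up to the desired value plus exactly this product; the potentials at the
    -- intermediate point cancel.
    have hprod := mul_pos (sub_pos.2 hc) (sub_pos.2 hanti)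
    rw [h.energy_eq_add hp2 x₁]
    linarith

/-- The median must be 0, by the strict bound applied to `u` or to its reflection; then the equality
case at the median applies, and `u 0 > 0` fixes the sign. -/
theorem eq_of_energy_le (P : Profile p φ ψ) (hp2 : 2 < p) (hp6 : p < 6) (h : H1Pair u g)
    {y : ℝ} (hy : 0 < y) (hm : mass u = 2 * leftMass φ (-y)) (h0 : u 0 = φ y)
    (hle : energy p u ≤ 2 * (φ y ^ 4 * slope φ ψ (-y) + potential p φ (-y))) :
    u = fun x => φ (|x| + y) := by
  have hmed : leftMass u 0 = leftMass φ (-y) := by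
    rcases lt_trichotomy (leftMass u 0) (leftMass φ (-y)) with hlt | heq | hgt
    · linarith [P.energy_gt_of_leftMass_lt hp2 hp6 h hy hm h0 hlt]
    · exact heq
    · have h1 := h.leftMass_add_leftMass_neg 0
      rw [neg_zero] at h1
      have h2 : energy p (fun x => u (-x)) = energy p u := by
        rw [h.comp_neg.energy_eq, h.energy_eq, integral_neg_eq_self (fun x => |u x| ^ p)]
        simp only [neg_sq]
        rw [integral_neg_eq_self (fun x => g x ^ 2)]
      have h3 : mass (fun x => u (-x)) = mass u := integral_neg_eq_self (fun x => u x ^ 2) volume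
      have := P.energy_gt_of_leftMass_lt hp2 hp6 h.comp_neg hy (h3.trans hm)
        (by simpa using h0) (by linarith)
      linarith
  have hsq := P.sq_eq_of_energy_le hp2 hp6 h hm hmed (by rw [h0]; exact hle)
  simp only [sub_zero] at hsq
  rcases P.eq_or_eq_neg_of_sq_eq h.continuous (continuous_abs.add continuous_const) hsq with h1 | h1
  · exact h1
  · have h2 : u 0 = -φ (|0| + y) := congrFun h1 0
    linarith [P.pos y, P.pos (|0| + y)]

/-- The solution of the problem when the value at the origin is large. -/
theorem solutions_abs (P : Profile p φ ψ) (hp2 : 2 < p) (hp6 : p < 6) {y : ℝ} (hy : 0 < y) :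
    solutions p (2 * leftMass φ (-y)) (φ y) = {fun x => φ (|x| + y)} := by
  have hadm : (fun x => φ (|x| + y)) ∈ Admissible (2 * leftMass φ (-y)) (φ y) :=
    ⟨(P.h1Pair_abs y).memH1, P.mass_abs y, by simp⟩
  have huniq : ∀ u ∈ Admissible (2 * leftMass φ (-y)) (φ y),
      energy p u ≤ energy p (fun x => φ (|x| + y)) → u = fun x => φ (|x| + y) :=
    fun u hu hle => P.eq_of_energy_le hp2 hp6 hu.1.h1Pair hy hu.2.1 hu.2.2
      (by rwa [P.energy_abs hp2] at hle)
  ext u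
  constructor
  · rintro ⟨hu, hmin⟩
    exact huniq u hu (hmin hadm)
  · rintro rfl
    refine ⟨hadm, fun u hu => ?_⟩
    show energy p (fun x => φ (|x| + y)) ≤ energy p u
    by_contra! hlt
    rw [huniq u hu hlt.le] at hlt
    exact lt_irrefl _ hlt

end Profile

/-! ### Explicit profiles. -/

/-- The explicit family of profiles. -/
noncomputable def sech (p k x : ℝ) : ℝ :=
  (p * k ^ 2 / 2) ^ (1 / (p - 2)) * Real.cosh ((p - 2) / 2 * k * x) ^ (-(2 / (p - 2)))

/-- The derivative of `sech`. -/
noncomputable def sechDeriv (p k x : ℝ) : ℝ :=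
  -k * (Real.sinh ((p - 2) / 2 * k * x) / Real.cosh ((p - 2) / 2 * k * x)) * sech p k x

variable {p k : ℝ}

theorem sech_pos (hp2 : 2 < p) (hk : 0 < k) (x : ℝ) : 0 < sech p k x := by
  have := Real.cosh_pos ((p - 2) / 2 * k * x)
  unfold sech
  positivity

theorem sech_even (p k x : ℝ) : sech p k (-x) = sech p k x := by
  rw [sech, sech, mul_neg, Real.cosh_neg]

theorem hasDerivAt_mul_left (c x : ℝ) : HasDerivAt (fun x => c * x) c x := by
  simpa using (hasDerivAt_id x).const_mul c

theorem hasDerivAt_sech (hp2 : 2 < p) (x : ℝ) : HasDerivAt (sech p k) (sechDeriv p k x) x := by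
  have hc := Real.cosh_pos ((p - 2) / 2 * k * x)
  have h1 := (hasDerivAt_mul_left ((p - 2) / 2 * k) x).cosh
  have h2 := (h1.rpow_const (p := -(2 / (p - 2))) (Or.inl hc.ne')).const_mul
    ((p * k ^ 2 / 2) ^ (1 / (p - 2)))
  refine h2.congr_deriv ?_
  have hp : p - 2 ≠ 0 := by linarith
  rw [sechDeriv, sech, Real.rpow_sub_one hc.ne']
  field_simp

/-- The exponents are chosen so that `sech ^ (p - 2)` is a multiple of `cosh⁻²`; this turns the
stationary equation into a rational identity in `sinh` and `cosh`. -/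
theorem sech_rpow (hp2 : 2 < p) (hk : 0 < k) (x : ℝ) :
    sech p k x ^ p =
      p * k ^ 2 / 2 / Real.cosh ((p - 2) / 2 * k * x) ^ 2 * sech p k x ^ 2 := by
  have hc := Real.cosh_pos ((p - 2) / 2 * k * x)
  have hp : p - 2 ≠ 0 := by linarith
  have h1 : sech p k x ^ (p - 2) = p * k ^ 2 / 2 / Real.cosh ((p - 2) / 2 * k * x) ^ 2 := by
    rw [sech, Real.mul_rpow (by positivity) (by positivity), ← Real.rpow_mul (by positivity),
      ← Real.rpow_mul hc.le, one_div_mul_cancel hp, Real.rpow_one, neg_mul, div_mul_cancel₀ _ hp,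
      Real.rpow_neg hc.le, Real.rpow_two]
    rfl
  rw [← h1, ← Real.rpow_two, ← Real.rpow_add (sech_pos hp2 hk x)]
  ring_nf

theorem hasDerivAt_sechDeriv (hp2 : 2 < p) (hk : 0 < k) (x : ℝ) :
    HasDerivAt (sechDeriv p k)
      ((sechDeriv p k x ^ 2 - (1 - 2 / p) * sech p k x ^ p) / sech p k x) x := by
  have hc := Real.cosh_pos ((p - 2) / 2 * k * x)
  have hl := hasDerivAt_mul_left ((p - 2) / 2 * k) x
  have h := ((hl.sinh.div hl.cosh hc.ne').const_mul (-k)).mul (hasDerivAt_sech (k := k) hp2 x)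
  refine h.congr_deriv ?_
  rw [sech_rpow hp2 hk]
  have h0 := (sech_pos hp2 hk x).ne'
  have hp : p ≠ 0 := by linarith
  have hsq := Real.cosh_sq ((p - 2) / 2 * k * x)
  simp only [sechDeriv, Pi.div_apply]
  generalize (p - 2) / 2 * k * x = w at *
  field_simp
  rw [hsq]
  ring

theorem abs_sechDeriv_le (hp2 : 2 < p) (hk : 0 < k) (x : ℝ) :
    |sechDeriv p k x| ≤ k * sech p k x := by
  have h0 := sech_pos hp2 hk x
  rw [sechDeriv, ← Real.tanh_eq_sinh_div_cosh, abs_mul, abs_mul, abs_neg, abs_of_pos hk,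
    abs_of_pos h0, mul_assoc]
  have := mul_le_mul_of_nonneg_right (Real.abs_tanh_lt_one ((p - 2) / 2 * k * x)).le h0.le
  rw [one_mul] at this
  gcongr

theorem sechDeriv_neg (hp2 : 2 < p) (hk : 0 < k) {x : ℝ} (hx : 0 < x) : sechDeriv p k x < 0 := by
  have h0 := sech_pos hp2 hk x
  have hb : 0 < (p - 2) / 2 * k * x := by
    have : 0 < p - 2 := by linarith
    positivity
  have h1 := Real.sinh_pos_iff.2 hb
  have hc := Real.cosh_pos ((p - 2) / 2 * k * x)
  rw [sechDeriv, neg_mul, neg_mul]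
  exact neg_neg_of_pos (by positivity)

theorem exp_rpow_eq (hp2 : 2 < p) (k x : ℝ) :
    Real.exp ((p - 2) / 2 * k * x) ^ (-(2 / (p - 2))) = Real.exp (-(k * x)) := by
  have hp : p - 2 ≠ 0 := by linarith
  rw [← Real.exp_mul]
  congr 1
  field_simp

theorem sech_le (hp2 : 2 < p) (hk : 0 < k) (x : ℝ) :
    sech p k x ≤ (p * k ^ 2 / 2) ^ (1 / (p - 2)) * 2 ^ (2 / (p - 2)) * Real.exp (k * x) := by
  have h1 : Real.exp ((p - 2) / 2 * k * -x) / 2 ≤ Real.cosh ((p - 2) / 2 * k * x) := by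
    rw [Real.cosh_eq, mul_neg]
    linarith [Real.exp_pos ((p - 2) / 2 * k * x)]
  have hp : 0 < p - 2 := by linarith
  have h2 := Real.rpow_le_rpow_of_nonpos (z := -(2 / (p - 2))) (by positivity) h1
    (by rw [neg_nonpos]; positivity)
  rw [Real.div_rpow (Real.exp_pos _).le (by norm_num), exp_rpow_eq hp2, Real.rpow_neg two_pos.le,
    div_inv_eq_mul, mul_neg, neg_neg] at h2
  rw [mul_comm (Real.exp (k * x))] at h2
  rw [sech, mul_assoc _ _ (Real.exp (k * x))]
  gcongr

theorem le_sech (hp2 : 2 < p) (hk : 0 < k) {x : ℝ} (hx : 0 ≤ x) :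
    (p * k ^ 2 / 2) ^ (1 / (p - 2)) * Real.exp (-(k * x)) ≤ sech p k x := by
  have hp : 0 < p - 2 := by linarith
  have h1 : Real.cosh ((p - 2) / 2 * k * x) ≤ Real.exp ((p - 2) / 2 * k * x) := by
    have : -((p - 2) / 2 * k * x) ≤ (p - 2) / 2 * k * x := by
      have : 0 ≤ (p - 2) / 2 * k * x := by positivity
      linarith
    rw [Real.cosh_eq]
    linarith [Real.exp_le_exp.2 this]
  have h2 := Real.rpow_le_rpow_of_nonpos (z := -(2 / (p - 2))) (Real.cosh_pos _) h1
    (by rw [neg_nonpos]; positivity)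
  rw [exp_rpow_eq hp2] at h2
  rw [sech]
  gcongr

theorem sech_sq_le (hp2 : 2 < p) (hk : 0 < k) (x : ℝ) :
    sech p k x ^ 2 ≤ ((p * k ^ 2 / 2) ^ (1 / (p - 2)) * 2 ^ (2 / (p - 2))) ^ 2 *
      Real.exp (2 * k * x) := by
  have h := pow_le_pow_left₀ (sech_pos hp2 hk x).le (sech_le hp2 hk x) 2
  rw [mul_pow _ (Real.exp _), ← Real.exp_nat_mul] at h
  rwa [Nat.cast_two, ← mul_assoc] at h

theorem continuous_sech (hp2 : 2 < p) : Continuous (sech p k) :=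
  continuous_iff_continuousAt.2 fun x => (hasDerivAt_sech hp2 x).continuousAt

theorem integrable_sech_sq (hp2 : 2 < p) (hk : 0 < k) : Integrable fun x => sech p k x ^ 2 := by
  set f : ℝ → ℝ := (Iic 0).indicator fun x =>
    ((p * k ^ 2 / 2) ^ (1 / (p - 2)) * 2 ^ (2 / (p - 2))) ^ 2 * Real.exp (2 * k * x) with hf
  have hf0 : ∀ x, 0 ≤ f x := fun x => indicator_nonneg (fun x _ => by positivity) x
  have hfi : Integrable f :=
    (integrable_indicator_iff measurableSet_Iic).2
      ((integrableOn_exp_mul_Iic (by positivity) 0).const_mul _)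
  refine (hfi.add hfi.comp_neg).mono' ((continuous_sech hp2).pow 2).aestronglyMeasurable
    (Eventually.of_forall fun x => ?_)
  rw [Real.norm_of_nonneg (by positivity), Pi.add_apply]
  rcases le_total x 0 with hx | hx
  · have : f x = _ := indicator_of_mem (mem_Iic.2 hx) _
    linarith [sech_sq_le hp2 hk x, hf0 (-x)]
  · have : f (-x) = _ := indicator_of_mem (mem_Iic.2 (neg_nonpos.2 hx)) _
    have h2 := sech_sq_le hp2 hk (-x)
    rw [sech_even] at h2
    linarith [hf0 x]

theorem profile_sech (hp2 : 2 < p) (hk : 0 < k) : Profile p (sech p k) (sechDeriv p k) where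
  pos := sech_pos hp2 hk
  even := sech_even p k
  hasDerivAt := hasDerivAt_sech hp2
  hasDerivAt_deriv := hasDerivAt_sechDeriv hp2 hk
  deriv_neg := fun _ => sechDeriv_neg hp2 hk
  exists_abs_deriv_le := ⟨k, abs_sechDeriv_le hp2 hk⟩
  h1Pair := by
    have hc' : Continuous (sechDeriv p k) :=
      continuous_iff_continuousAt.2 fun x => (hasDerivAt_sechDeriv hp2 hk x).continuousAt
    have h1 : MemLp (sech p k) 2 volume :=
      (memLp_two_iff_integrable_sq (continuous_sech hp2).aestronglyMeasurable).2
        (integrable_sech_sq hp2 hk)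
    have h2 : MemLp (sechDeriv p k) 2 volume := by
      refine (h1.const_mul k).mono hc'.aestronglyMeasurable (Eventually.of_forall fun x => ?_)
      rw [Real.norm_eq_abs]
      exact (abs_sechDeriv_le hp2 hk x).trans (le_abs_self _)
    exact ⟨⟨hc'.locallyIntegrable, fun x y => (intervalIntegral.integral_eq_sub_of_hasDerivAt
      (fun t _ => hasDerivAt_sech hp2 t) (hc'.intervalIntegrable _ _)).symm⟩, h1, h2⟩

/-! ### Scaling and the choice of the parameters. -/

theorem sech_eq_scale (hp2 : 2 < p) (hk : 0 < k) (x : ℝ) :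
    sech p k x = k ^ (2 / (p - 2)) * sech p 1 (k * x) := by
  have : (p * k ^ 2 / 2) ^ (1 / (p - 2)) =
      k ^ (2 / (p - 2)) * (p * 1 ^ 2 / 2) ^ (1 / (p - 2)) := by
    rw [show p * k ^ 2 / 2 = k ^ 2 * (p * 1 ^ 2 / 2) by ring,
      Real.mul_rpow (by positivity) (by positivity), ← Real.rpow_two, ← Real.rpow_mul hk.le]
    ring_nf
  rw [sech, sech, this, mul_one]
  ring_nf

theorem leftMass_sech (hp2 : 2 < p) (hk : 0 < k) (t : ℝ) :
    leftMass (sech p k) t = k ^ ((6 - p) / (p - 2)) * leftMass (sech p 1) (k * t) := by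
  have key : ∀ k t, leftMass (sech p k) t = ∫ x in Ioi (-t), sech p k x ^ 2 := fun k t => by
    rw [← integral_comp_neg_Iic t (fun x => sech p k x ^ 2)]
    simp only [sech_even, leftMass]
  have h2 : k ^ ((6 - p) / (p - 2)) = (k ^ (2 / (p - 2))) ^ 2 * k⁻¹ := by
    rw [← Real.rpow_two, ← Real.rpow_mul hk.le, ← Real.rpow_neg_one, ← Real.rpow_add hk]
    congr 1
    have hp : p - 2 ≠ 0 := by linarith
    field_simp
    ring
  have h1 := integral_comp_mul_left_Ioi (fun x => sech p 1 x ^ 2) (-t) hk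
  rw [key, key, h2, mul_assoc, ← mul_neg, ← smul_eq_mul (a := k⁻¹), ← h1, ← integral_const_mul]
  refine setIntegral_congr_fun measurableSet_Ioi fun x _ => ?_
  rw [sech_eq_scale hp2 hk x]
  ring

theorem mass_sech (hp2 : 2 < p) (hk : 0 < k) :
    mass (sech p k) = k ^ ((6 - p) / (p - 2)) * mass (sech p 1) := by
  rw [← (profile_sech hp2 hk).two_mul_leftMass_zero,
    ← (profile_sech hp2 one_pos).two_mul_leftMass_zero, leftMass_sech hp2 hk, mul_zero]
  ring

theorem exists_mass_sech_eq (hp2 : 2 < p) (hp6 : p < 6) {m : ℝ} (hm : 0 < m) :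
    ∃ k, 0 < k ∧ mass (sech p k) = m := by
  have hc := (profile_sech hp2 one_pos).mass_pos
  have he : (6 - p) / (p - 2) ≠ 0 := (div_pos (by linarith) (by linarith)).ne'
  have hk : 0 < (m / mass (sech p 1)) ^ ((6 - p) / (p - 2))⁻¹ := by positivity
  refine ⟨_, hk, ?_⟩
  rw [mass_sech hp2 hk, ← Real.rpow_mul (by positivity), inv_mul_cancel₀ he, Real.rpow_one,
    div_mul_cancel₀ _ hc.ne']

/-- The tail mass is at most, and the squared value at least, a constant times `exp (-2z)`. -/
theorem leftMass_sech_neg_le (hp2 : 2 < p) {z : ℝ} (hz : 0 ≤ z) :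
    leftMass (sech p 1) (-z) ≤ (2 ^ (2 / (p - 2))) ^ 2 / 2 * sech p 1 z ^ 2 := by
  set A := (p * 1 ^ 2 / 2) ^ (1 / (p - 2)) with hA
  set B := (2 : ℝ) ^ (2 / (p - 2)) with hB
  have h1 : leftMass (sech p 1) (-z) ≤ ∫ x in Iic (-z), (A * B) ^ 2 * Real.exp (2 * x) := by
    refine setIntegral_mono_on (integrable_sech_sq hp2 one_pos).integrableOn
      ((integrableOn_exp_mul_Iic (by norm_num) _).const_mul _) measurableSet_Iic fun x _ => ?_
    have := sech_sq_le hp2 one_pos x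
    rwa [mul_one (2 : ℝ)] at this
  rw [integral_const_mul, integral_exp_mul_Iic (by norm_num)] at h1
  have hA0 : 0 ≤ A := by positivity
  have h2 := pow_le_pow_left₀ (by positivity) (le_sech hp2 one_pos hz) 2
  rw [mul_pow, ← Real.exp_nat_mul, ← hA] at h2
  have e : Real.exp (2 * -z) = Real.exp ((2 : ℕ) * -(1 * z)) := by
    congr 1
    push_cast
    ring
  rw [e] at h1
  calc _ ≤ _ := h1
    _ = B ^ 2 / 2 * (A ^ 2 * Real.exp ((2 : ℕ) * -(1 * z))) := by ring
    _ ≤ _ := by gcongr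

theorem sech_zero_lt {k' : ℝ} (hp2 : 2 < p) (hk : 0 < k) (hk' : 0 < k')
    (h : sech p k 0 < sech p k' 0) : k < k' := by
  rw [sech_eq_scale hp2 hk, sech_eq_scale hp2 hk', mul_zero, mul_zero,
    mul_lt_mul_iff_left₀ (sech_pos hp2 one_pos 0)] at h
  exact (Real.rpow_lt_rpow_iff hk.le hk'.le (div_pos two_pos (by linarith))).1 h

/-- Profiles with prescribed value at `y` and prescribed mass outside `[-y, y]`. -/
theorem exists_sech_eq (hp2 : 2 < p) (hp6 : p < 6) (hk : 0 < k) {a : ℝ} (ha : sech p k 0 < a) :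
    ∃ k' y, 0 < k' ∧ 0 < y ∧ sech p k' y = a ∧
      2 * leftMass (sech p k') (-y) = mass (sech p k) := by
  have hp : 0 < p - 2 := by linarith
  have ha0 : 0 < a := (sech_pos hp2 hk 0).trans ha
  have P := profile_sech hp2 one_pos
  -- With `z = k' * y` as parameter, the condition on the value at `y` determines `k' = κ z`. The
  -- mass outside `[-y, y]` becomes `F z`, and the intermediate value theorem applies to `F`.
  set κ : ℝ → ℝ := fun z => (a / sech p 1 z) ^ ((p - 2) / 2) with hκ
  have hκ0 : ∀ z, 0 < κ z := fun z => by
    have := P.pos z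
    positivity
  have hval : ∀ z, sech p (κ z) (z / κ z) = a := fun z => by
    have h1 : κ z ^ (2 / (p - 2)) = a / sech p 1 z := by
      have := P.pos z
      rw [hκ, ← Real.rpow_mul (by positivity), div_mul_div_comm, mul_comm (p - 2),
        div_self (by positivity), Real.rpow_one]
    rw [sech_eq_scale hp2 (hκ0 z), mul_div_cancel₀ _ (hκ0 z).ne', h1,
      div_mul_cancel₀ _ (P.pos z).ne']
  set F : ℝ → ℝ := fun z => 2 * (κ z ^ ((6 - p) / (p - 2)) * leftMass (sech p 1) (-z)) with hF
  have hFeq : ∀ z, 2 * leftMass (sech p (κ z)) (-(z / κ z)) = F z := fun z => by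
    rw [leftMass_sech hp2 (hκ0 z), mul_neg, mul_div_cancel₀ _ (hκ0 z).ne']
  have hFc : Continuous F := by
    refine continuous_const.mul (Continuous.mul ?_
      (P.h1Pair.continuous_leftMass.comp continuous_neg))
    refine Continuous.rpow_const ?_ fun z => Or.inl (hκ0 z).ne'
    exact (continuous_const.div P.continuous fun z => (P.pos z).ne').rpow_const
      fun z => Or.inl (div_pos ha0 (P.pos z)).ne'
  have hF0 : mass (sech p k) < F 0 := by
    have h1 : k < κ 0 := by
      refine sech_zero_lt hp2 hk (hκ0 0) ?_
      have := hval 0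
      rw [zero_div] at this
      rwa [this]
    rw [mass_sech hp2 hk, ← P.two_mul_leftMass_zero, hF]
    beta_reduce
    rw [neg_zero]
    have h2 := Real.rpow_lt_rpow hk.le h1 (show 0 < (6 - p) / (p - 2) from
      div_pos (by linarith) hp)
    have := mul_lt_mul_of_pos_right h2 (P.leftMass_pos 0)
    linarith
  have hFlim : Tendsto F atTop (𝓝 0) := by
    -- The factor `κ` grows like `sech ^ (-(6 - p) / 2)` while the tail mass is of order `sech ^ 2`,
    -- which leaves the positive power `(p - 2) / 2`.
    have hle : ∀ z, 0 ≤ z → F z ≤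
        (2 ^ (2 / (p - 2))) ^ 2 * a ^ ((6 - p) / 2) * sech p 1 z ^ ((p - 2) / 2) := by
      intro z hz
      have hs := P.pos z
      have h1 : κ z ^ ((6 - p) / (p - 2)) = a ^ ((6 - p) / 2) / sech p 1 z ^ ((6 - p) / 2) := by
        rw [hκ, ← Real.rpow_mul (by positivity), ← Real.div_rpow ha0.le hs.le]
        congr 1
        field_simp
      have h2 : sech p 1 z ^ 2 = sech p 1 z ^ ((6 - p) / 2) * sech p 1 z ^ ((p - 2) / 2) := by
        rw [← Real.rpow_add hs, ← Real.rpow_two]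
        ring_nf
      have h3 := mul_le_mul_of_nonneg_left (leftMass_sech_neg_le hp2 hz)
        (show 0 ≤ κ z ^ ((6 - p) / (p - 2)) from (Real.rpow_pos_of_pos (hκ0 z) _).le)
      have h4 : 0 < sech p 1 z ^ ((6 - p) / 2) := by positivity
      calc F z ≤ 2 * (κ z ^ ((6 - p) / (p - 2)) *
            ((2 ^ (2 / (p - 2))) ^ 2 / 2 * sech p 1 z ^ 2)) := by
            simp only [hF]
            linarith
        _ = _ := by
            rw [h1, h2]
            field_simp
    have hlim : Tendsto (fun z => (2 ^ (2 / (p - 2))) ^ 2 * a ^ ((6 - p) / 2) *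
        sech p 1 z ^ ((p - 2) / 2)) atTop (𝓝 0) := by
      have := (P.tendsto_atTop.rpow_const (p := (p - 2) / 2) (Or.inr (by linarith))).const_mul
        ((2 ^ (2 / (p - 2))) ^ 2 * a ^ ((6 - p) / 2))
      rwa [Real.zero_rpow (by linarith), mul_zero] at this
    refine squeeze_zero' (Eventually.of_forall fun z => ?_)
      ((eventually_ge_atTop 0).mono hle) hlim
    have := hκ0 z
    have := leftMass_nonneg (sech p 1) (-z)
    simp only [hF]
    positivity
  obtain ⟨Z, hZ, hZ0⟩ := ((hFlim.eventually (gt_mem_nhds (profile_sech hp2 hk).mass_pos)).and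
    (eventually_ge_atTop 0)).exists
  obtain ⟨z, hz, hz'⟩ := intermediate_value_Icc' hZ0 hFc.continuousOn
    (show mass (sech p k) ∈ Icc (F Z) (F 0) from ⟨hZ.le, hF0.le⟩)
  have hz0 : 0 < z := hz.1.lt_of_ne fun h => by
    rw [← h] at hz'
    linarith
  exact ⟨κ z, z / κ z, hκ0 z, div_pos hz0 (hκ0 z), hval z, (hFeq z).trans hz'⟩

end NLSLine

/-! ### The main theorem. -/

theorem mainTheorem7 (p : ℝ) (hp2 : 2 < p) (hp6 : p < 6) :
    -- the soliton of every mass exists and is unique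
    (∀ μ : ℝ, 0 < μ → NLSLine.IsSoliton p μ (NLSLine.soliton p μ) ∧
      ∀ ψ : ℝ → ℝ, NLSLine.IsSoliton p μ ψ → ψ = NLSLine.soliton p μ) ∧
    ∀ a m : ℝ, 0 < a → 0 < m →
      (a < NLSLine.soliton p m 0 →
        ∃ y : ℝ, 0 < y ∧
          (fun x : ℝ => NLSLine.soliton p m (x + y)) ≠
            (fun x : ℝ => NLSLine.soliton p m (x - y)) ∧
          NLSLine.solutions p m a =
            {fun x : ℝ => NLSLine.soliton p m (x + y),
              fun x : ℝ => NLSLine.soliton p m (x - y)}) ∧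
      (a = NLSLine.soliton p m 0 →
        NLSLine.solutions p m a = {NLSLine.soliton p m}) ∧
      (NLSLine.soliton p m 0 < a →
        ∃ M y : ℝ, 0 < M ∧ 0 < y ∧
          NLSLine.solutions p m a =
            {fun x : ℝ => NLSLine.soliton p M (|x| + y)}) := by
  refine ⟨fun μ hμ => ?_, fun a m ha hm => ?_⟩
  · obtain ⟨k, hk, rfl⟩ := NLSLine.exists_mass_sech_eq hp2 hp6 hμ
    have P := NLSLine.profile_sech hp2 hk
    rw [P.soliton_mass hp2 hp6]
    exact ⟨P.isSoliton hp2 hp6, fun ψ => P.eq_of_isSoliton hp2 hp6⟩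
  · obtain ⟨k, hk, rfl⟩ := NLSLine.exists_mass_sech_eq hp2 hp6 hm
    have P := NLSLine.profile_sech hp2 hk
    rw [P.soliton_mass hp2 hp6]
    refine ⟨fun hlt => ?_, ?_, fun hlt => ?_⟩
    · obtain ⟨Y, hY, hY0⟩ := ((P.tendsto_atTop.eventually (gt_mem_nhds ha)).and
        (eventually_ge_atTop 0)).exists
      obtain ⟨y, hy, rfl⟩ := intermediate_value_Icc' hY0 P.continuous.continuousOn
        ⟨hY.le, hlt.le⟩
      have hy0 : 0 < y := hy.1.lt_of_ne fun h => by
        rw [← h] at hlt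
        exact lt_irrefl _ hlt
      refine ⟨y, hy0, fun h => ?_, P.solutions_mass hp2 hp6 hy0.le⟩
      -- Evaluation at `y` would give `φ (2y) = φ 0`, against strict monotonicity.
      have h1 := congrFun h y
      simp only [sub_self] at h1
      linarith [P.eq_of_apply_eq (by linarith) le_rfl h1]
    -- For `y = 0` the two translates coincide.
    · rintro rfl
      simpa using P.solutions_mass hp2 hp6 le_rfl
    · obtain ⟨k', y, hk', hy, rfl, hm'⟩ := NLSLine.exists_sech_eq hp2 hp6 hk hlt
      have P' := NLSLine.profile_sech hp2 hk'
      refine ⟨NLSLine.mass (NLSLine.sech p k'), y, P'.mass_pos, hy, ?_⟩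
      rw [P'.soliton_mass hp2 hp6, ← hm']
      exact P'.solutions_abs hp2 hp6 hy
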